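/- Let $N\ge 2$, let $y_1,\dots,y_N\in\mathbb R^3$ be distinct points, $Y=(y_j)_{j=1}^N$, and let $a=(a_j)_{j=1}^N\in\mathbb C^N$. Let $$\Gamma_{a,Y}(z)=\Big[\big(a_j-\tfrac{iz}{4\pi}\big)\delta_{jj'}-\widetilde G_z(y_j-y_{j'})\Big]_{j,j'=1}^N,\qquad \widetilde G_z(x)=\frac{e^{iz|x|}}{4\pi|x|}\ (x\ne0),\quad \widetilde G_z(0)=0 .$$ The multiset $\Sigma(H_{a,Y})$ of resonances of the point interaction Hamiltonian $H_{a,Y}$ is the multiset of zeros of $\det\Gamma_{a,Y}(\cdot)$, counted with multiplicity as zeros of this analytic function. Write $D(\zeta)=(-4\pi)^N\det\Gamma_{a,Y}(i\zeta)$ in the canonical form $D(\zeta)=\sum_{b}P_b(\zeta)e^{b\zeta}$, a finite sum over the real numbers $b$ (the frequencies) with polynomial $P_b\not\equiv0$; put $P_b\equiv 0$ for every other real $b$. The distribution diagram of $D$ is the polygonal line, convex upward (i.e. the graph of a concave function), that joins the point $(b,\deg P_b)$ of the smallest frequency $b$ to that of the largest frequency, has its vertices among the points $(b,\deg P_b)$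 ($b$ a frequency), and has none of these points strictly above it. Let $M=M(a,Y)$ be the number of its maximal segments, numbered from left to right; let $\mu_n=\mu_n(a,Y)$ be the slope of the $n$-th segment and $r_n$ the difference of the ordinates of its right and left endpoints. Let $q_n(\omega)=\sum_b c_b\,\omega^{\deg P_b-m_{n,1}}$, where the sum is over the frequencies $b$ whose points lie on the $n$-th segment, $c_b$ is the leading coefficient of $P_b$, and $m_{n,1}$ is the ordinate of the left endpoint of the $n$-th segment. For $m=0$ and $2\le m\le N$ let $\mathrm{Size}_m$ be the maximum of $\sum_{j=1}^N|y_j-y_{\sigma(j)}|$ over the permutations $\sigma$ of $\{1,\dots,N\}$ with exactly $m$ non-fixed points, and let $\mathrm{Size}_1=\operatorname{diam}Y=\max_{j,j'}|y_j-y_{j'}|$. **Theorem.** Assume: (A3) for $3\le n\le N$: $P_{-\mathrm{Size}_n}\not\equiv0$ and $\deg P_{-\mathrm{Size}_n}=N-n$; (A4) for $2\le m\le N-1$: $\mathrm{Size}_m-\mathrm{Size}_{m-1}>\mathrm{Size}_{m+1}-\mathrm{Size}_m>0$ (no condition if $N=2$). Then: (i) $M(a,Y)=N-1$ and $\mu_{N-m}(a,Y)=\dfrac1{\mathrm{Size}_{m+1}-\mathrm{Size}_m}$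 for $m=1,\dots,N-1$. (ii) $r_{N-1}=2$, $r_n=1$ for $1\le n\le N-2$, and, after possible exclusion of a finite number of resonances, the multiset $\Sigma(H_{a,Y})$ decomposes (taking multiplicities into account) into the $2N=2\sum_{n=1}^{M}r_n$ sequences $(k^{\pm}_{n,j,t})_{t\ge t_{n,j}}$, $1\le n\le M$, $1\le j\le r_n$, where $t_{n,j}\ge 1$ are integers and, as $t\to+\infty$, $$\frac{k^{\pm}_{n,j,t}}{\mu_n}=\pm2\pi t-i\,\mathrm{Ln}(t)\mp\frac{\pi}{2}-i\,\mathrm{Ln}(2\pi\mu_n)+i\,\mathrm{Ln}(\omega_{n,j})+o(1).$$ Here $\omega_{n,1},\dots,\omega_{n,r_n}\in\mathbb C\setminus\{0\}$ are the zeros of $q_n$, repeated according to multiplicity, and $\mathrm{Ln}$ is the principal branch of the logarithm, with $\mathrm{Ln}(x)=\ln|x|+i\pi$ for $x<0$. (iii) There exists $R\ge0$ such that every resonance $k$ with $|k|\ge R$ is simple, i.e. of multiplicity $1$. -/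

import Mathlib

open Polynomial

noncomputable section

namespace PointInteraction

/-- Three-dimensional Euclidean space. -/
abbrev E3 : Type := EuclideanSpace ℝ (Fin 3)

variable {N : ℕ}

/-! ### The matrix `Γ`, its determinant, and resonances -/

/-- The free Green function `G_z(x) = exp(i z |x|) / (4 π |x|)`, replaced by `0` at `x = 0`. -/
def greenTilde (z : ℂ) (x : E3) : ℂ :=
  if x = 0 then 0
  else Complex.exp (Complex.I * z * (‖x‖ : ℂ)) / (4 * (Real.pi : ℂ) * (‖x‖ : ℂ))

/-- The matrix `Γ_{a,Y}(z)` of the point interaction Hamiltonian `H_{a,Y}` with centers `Y` and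
strength parameters `a`. -/
def gammaMatrix (a : Fin N → ℂ) (Y : Fin N → E3) (z : ℂ) : Matrix (Fin N) (Fin N) ℂ :=
  Matrix.of fun j j' =>
    (if j = j' then a j - Complex.I * z / (4 * (Real.pi : ℂ)) else 0) - greenTilde z (Y j - Y j')

/-- The characteristic determinant `det Γ_{a,Y}`; its zeros are the resonances of `H_{a,Y}`. -/
def charDet (a : Fin N → ℂ) (Y : Fin N → E3) (z : ℂ) : ℂ := (gammaMatrix a Y z).det

/-- `k` is a resonance of `H_{a,Y}`. -/
def IsResonance (a : Fin N → ℂ) (Y : Fin N → E3) (k : ℂ) : Prop := charDet a Y k = 0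

/-- The multiplicity of `k` in the multiset of resonances: the order of vanishing at `k` of the
characteristic determinant (`0` if `k` is not a resonance). -/
def resonanceMult (a : Fin N → ℂ) (Y : Fin N → E3) (k : ℂ) : ℕ∞ :=
  analyticOrderAt (charDet a Y) k

/-- The modified characteristic determinant `D(ζ) = (-4π)^N det Γ_{a,Y}(i ζ)`. -/
def modDet (a : Fin N → ℂ) (Y : Fin N → E3) (ζ : ℂ) : ℂ :=
  (-4 * (Real.pi : ℂ)) ^ N * charDet a Y (Complex.I * ζ)

/-! ### The canonical form of `D` as an exponential polynomial -/

/-- The frequency `α(σ)` of the term of the Leibniz expansion of `D` that belongs to `σ`. -/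
def alpha (Y : Fin N → E3) (σ : Equiv.Perm (Fin N)) : ℝ :=
  -∑ j with σ j ≠ j, ‖Y j - Y (σ j)‖

/-- The polynomial `p^[σ]` of the term of the Leibniz expansion of `D` that belongs to `σ`. -/
def permPoly (a : Fin N → ℂ) (Y : Fin N → E3) (σ : Equiv.Perm (Fin N)) : ℂ[X] :=
  C (((Equiv.Perm.sign σ : ℤ) : ℂ) * ((∏ j with σ j ≠ j, ‖Y j - Y (σ j)‖⁻¹ : ℝ) : ℂ)) *
    ∏ j with σ j = j, (-X - C (4 * (Real.pi : ℂ) * a j))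

open scoped Classical in
/-- The polynomial `P_b` in the canonical form `D(ζ) = ∑_b P_b(ζ) exp(b ζ)` (zero if `b` is not a
frequency of `D`). -/
def freqPoly (a : Fin N → ℂ) (Y : Fin N → E3) (b : ℝ) : ℂ[X] :=
  ∑ σ : Equiv.Perm (Fin N) with alpha Y σ = b, permPoly a Y σ

open scoped Classical in
/-- The frequencies of `D`: the numbers `b` such that `P_b` is not the zero polynomial. -/
def freqs (a : Fin N → ℂ) (Y : Fin N → E3) : Finset ℝ :=
  (Finset.univ.image (alpha Y)).filter fun b => freqPoly a Y b ≠ 0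

theorem mem_freqs (a : Fin N → ℂ) (Y : Fin N → E3) (b : ℝ) :
    b ∈ freqs a Y ↔ freqPoly a Y b ≠ 0 := by
  classical
  simp only [freqs, Finset.mem_filter, and_iff_right_iff_imp]
  intro h
  obtain ⟨σ, hσ, -⟩ := Finset.exists_ne_zero_of_sum_ne_zero h
  exact Finset.mem_image.2 ⟨σ, Finset.mem_univ _, (Finset.mem_filter.1 hσ).2⟩

/-- The canonical form of `D`. -/
theorem modDet_eq_sum (a : Fin N → ℂ) (Y : Fin N → E3) (hY : Function.Injective Y) (ζ : ℂ) :
    modDet a Y ζ = ∑ b ∈ freqs a Y, (freqPoly a Y b).eval ζ * Complex.exp ((b : ℂ) * ζ) := by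
  classical
  have hpi : (Real.pi : ℂ) ≠ 0 := by exact_mod_cast Real.pi_ne_zero
  have h1 : modDet a Y ζ =
      ∑ σ : Equiv.Perm (Fin N), (permPoly a Y σ).eval ζ * Complex.exp ((alpha Y σ : ℂ) * ζ) := by
    have hsmul := Matrix.det_smul (gammaMatrix a Y (Complex.I * ζ)) (-4 * (Real.pi : ℂ))
    rw [Fintype.card_fin] at hsmul
    rw [modDet, charDet, ← hsmul, ← Matrix.det_transpose, Matrix.det_apply']
    refine Finset.sum_congr rfl fun σ _ => ?_
    have hterm : ∀ j : Fin N,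
        ((-4 * (Real.pi : ℂ)) • gammaMatrix a Y (Complex.I * ζ)).transpose (σ j) j =
          if σ j = j then -ζ - 4 * (Real.pi : ℂ) * a j
          else ((‖Y j - Y (σ j)‖⁻¹ : ℝ) : ℂ) *
            Complex.exp (((-‖Y j - Y (σ j)‖ : ℝ) : ℂ) * ζ) := by
      intro j
      simp only [Matrix.transpose_apply, Matrix.smul_apply, gammaMatrix, Matrix.of_apply,
        smul_eq_mul, greenTilde, sub_eq_zero, hY.eq_iff]
      by_cases h : σ j = j
      · simp only [h, if_true]
        field_simp
        linear_combination ζ * Complex.I_sq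
      · have h' : j ≠ σ j := fun e => h e.symm
        have hn : (‖Y j - Y (σ j)‖ : ℂ) ≠ 0 := by
          simpa [sub_eq_zero, hY.eq_iff] using h'
        have he : Complex.I * (Complex.I * ζ) * (‖Y j - Y (σ j)‖ : ℂ) =
            ((-‖Y j - Y (σ j)‖ : ℝ) : ℂ) * ζ := by
          push_cast
          linear_combination (ζ * (‖Y j - Y (σ j)‖ : ℂ)) * Complex.I_sq
        simp only [h, h', if_false]
        rw [he]
        push_cast
        field_simp
        ring
    rw [Finset.prod_congr rfl fun j _ => hterm j, Finset.prod_ite, Finset.prod_mul_distrib,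
      ← Complex.exp_sum, ← Finset.sum_mul]
    simp only [permPoly, alpha, eval_mul, eval_C, eval_prod, eval_sub, eval_neg, eval_X]
    push_cast
    rw [Finset.sum_neg_distrib]
    ring
  rw [h1, ← Finset.sum_fiberwise_of_maps_to (g := alpha Y) (t := Finset.univ.image (alpha Y))
    (fun σ hσ => Finset.mem_image_of_mem _ hσ), freqs, Finset.sum_filter_of_ne]
  · refine Finset.sum_congr rfl fun b _ => ?_
    rw [freqPoly, eval_finsetSum, Finset.sum_mul]
    refine Finset.sum_congr rfl fun σ hσ => ?_
    rw [(Finset.mem_filter.1 hσ).2]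
  · intro b _ hb h0
    exact hb (by rw [h0]; simp)

/-! ### The distribution diagram -/

/-- The distribution diagram of `D`. It is the polygonal line through the points
`T_b = (b, deg P_b)`, where `b` runs through `vertex 0 < vertex 1 < ⋯ < vertex M`; its `n`-th segment
(`1 ≤ n ≤ M`) joins `T_{vertex (n - 1)}` to `T_{vertex n}`. Values of `vertex` beyond `M` play no
role. -/
structure DistributionDiagram (a : Fin N → ℂ) (Y : Fin N → E3) where
  /-- the number of segments -/
  M : ℕ
  /-- the abscissas of the successive vertices -/
  vertex : ℕ → ℝ
  /-- the vertices are points `T_b` with `b` a frequency of `D` -/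
  vertex_mem : ∀ n ≤ M, vertex n ∈ freqs a Y
  /-- the line starts at the point that belongs to the smallest frequency -/
  vertex_zero : ∀ b ∈ freqs a Y, vertex 0 ≤ b
  /-- the line ends at the point that belongs to the largest frequency -/
  vertex_last : ∀ b ∈ freqs a Y, b ≤ vertex M
  /-- the vertices are numbered from left to right -/
  vertex_lt : ∀ n, 1 ≤ n → n ≤ M → vertex (n - 1) < vertex n
  /-- the line is convex upward, and consecutive segments do not lie on one straight line -/
  slope_lt : ∀ n, 1 ≤ n → n < M →
    (((freqPoly a Y (vertex (n + 1))).natDegree : ℝ) - (freqPoly a Y (vertex n)).natDegree) /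
        (vertex (n + 1) - vertex n) <
      (((freqPoly a Y (vertex n)).natDegree : ℝ) - (freqPoly a Y (vertex (n - 1))).natDegree) /
        (vertex n - vertex (n - 1))
  /-- no point `T_b` lies above the line -/
  below : ∀ b ∈ freqs a Y, ∀ n, 1 ≤ n → n ≤ M → vertex (n - 1) ≤ b → b ≤ vertex n →
    ((freqPoly a Y b).natDegree : ℝ) ≤ (freqPoly a Y (vertex (n - 1))).natDegree +
      (((freqPoly a Y (vertex n)).natDegree : ℝ) - (freqPoly a Y (vertex (n - 1))).natDegree) /
        (vertex n - vertex (n - 1)) * (b - vertex (n - 1))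

namespace DistributionDiagram

variable {a : Fin N → ℂ} {Y : Fin N → E3}

/-- The slope `μ_n` of the `n`-th segment, `1 ≤ n ≤ M`. -/
def slope (L : DistributionDiagram a Y) (n : ℕ) : ℝ :=
  (((freqPoly a Y (L.vertex n)).natDegree : ℝ) - (freqPoly a Y (L.vertex (n - 1))).natDegree) /
    (L.vertex n - L.vertex (n - 1))

/-- The multiplicity `r_n` of `μ_n`, `1 ≤ n ≤ M`: the height of the `n`-th segment. -/
def mult (L : DistributionDiagram a Y) (n : ℕ) : ℕ :=
  (freqPoly a Y (L.vertex n)).natDegree - (freqPoly a Y (L.vertex (n - 1))).natDegree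

open scoped Classical in
/-- The frequencies `b` whose points `T_b` lie on the `n`-th segment, `1 ≤ n ≤ M`. -/
def segFreqs (L : DistributionDiagram a Y) (n : ℕ) : Finset ℝ :=
  (freqs a Y).filter fun b => L.vertex (n - 1) ≤ b ∧ b ≤ L.vertex n ∧
    ((freqPoly a Y b).natDegree : ℝ) =
      (freqPoly a Y (L.vertex (n - 1))).natDegree + L.slope n * (b - L.vertex (n - 1))

/-- The polynomial `q_n`, `1 ≤ n ≤ M`, whose zeros are the second order parameters `ω_{n,j}`. -/
def segPoly (L : DistributionDiagram a Y) (n : ℕ) : ℂ[X] :=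
  ∑ b ∈ L.segFreqs n, C (freqPoly a Y b).leadingCoeff *
    X ^ ((freqPoly a Y b).natDegree - (freqPoly a Y (L.vertex (n - 1))).natDegree)

end DistributionDiagram

/-! ### Sizes of `Y` -/

/-- The `m`-size of `Y`: for `m = 1` the diameter, and for `m = 0` and `2 ≤ m ≤ N` the maximum of
`∑ j, |y_j - y_{σ j}|` over the permutations `σ` that move exactly `m` indices. -/
def size (Y : Fin N → E3) (m : ℕ) : ℝ :=
  if m = 1 then Metric.diam (Set.range Y)
  else sSup {x : ℝ | ∃ σ : Equiv.Perm (Fin N),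
    (Finset.univ.filter fun j => σ j ≠ j).card = m ∧ x = ∑ j, ‖Y j - Y (σ j)‖}

/-! ### Asymptotic sequences -/

/-- The logarithmic asymptotics, as `t → ∞`,
`k_t / μ = ± 2πt - i Ln t ∓ π/2 - i Ln (2πμ) + i Ln ω + o(1)`,
where `s = 1` for the upper signs and `s = -1` for the lower signs. -/
def HasLogAsymptotics (s μ : ℝ) (ω : ℂ) (k : ℕ → ℂ) : Prop :=
  Filter.Tendsto
    (fun t : ℕ => k t / (μ : ℂ) -
      ((s : ℂ) * (2 * (Real.pi : ℂ) * (t : ℂ)) - Complex.I * Complex.log (t : ℂ)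
        - (s : ℂ) * ((Real.pi : ℂ) / 2) - Complex.I * Complex.log (2 * (Real.pi : ℂ) * (μ : ℂ))
        + Complex.I * Complex.log ω))
    Filter.atTop (nhds 0)

/-- The number of times that the value `z` is taken by the sequence `k t₀, k (t₀ + 1), …`. -/
def seqCount (t₀ : ℕ) (k : ℕ → ℂ) (z : ℂ) : ℕ∞ := {t : ℕ | t₀ ≤ t ∧ k t = z}.encard

end PointInteraction

end

/-!
Up to the rotation `k = i ζ` the resonances are the zeros of the exponential polynomial
`D(ζ) = ∑ b, P_b(ζ) exp(b ζ)`.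

*The diagram.* A permutation that moves exactly `m` indices contributes to `D` a term with frequency
at least `-Size_m` and degree `N - m` (`neg_size_le_alpha`, `permPoly_natDegree_leadingCoeff`), so
for every point `(b, deg P_b)` there is an `m` with `b ≥ -Size_m` and `deg P_b ≤ N - m`. The points
`(-Size_m, N - m)` do occur: for `m ≥ 3` by assumption, for `m = 0` because only the identity has
frequency `0`, and for `m = 2` because all transpositions contribute leading coefficients of the same sign
(`freqPoly_neg_size_two`). The sizes form a strictly concave sequence once `m = 1` is left out, so
these points are exactly the vertices, and every other point lies strictly below each of the lines
that extend the segments (`sizeVertex_isEdgeChain`). A diagram whose segments contain no points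
besides their endpoints is unique (`IsEdgeChain.diagram_unique`), and its polynomials `q_n` are
binomials `c + d ω ^ r` with `r` distinct nonzero roots.

*The zeros.* The modulus of the leading monomial of `P_b(ζ) exp(b ζ)` is
`exp(deg P_b log|ζ| + b Re ζ)`. Hence for large `|ζ|` a single vertex dominates `D` unless `ζ` lies in
one of the strips `|Re ζ + μ_n log|ζ|| ≤ C` (`IsEdgeChain.exists_strip`), and in the `n`-th strip only
the two endpoints of the `n`-th segment matter: the equation `D(ζ) = 0` becomes
`(ζ exp(ζ / μ_n)) ^ r = κ Φ(ζ)` with `Φ → 1`, where `κ` is the `r`-th power of each root of `q_n`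
(`IsEdge.tendsto_edgeRatio`, `IsEdge.isEdgeForm`). Taking `r`-th roots and logarithms turns it into
`ζ / μ_n + Log ζ - Log ω - Log Φ(ζ) / r = ∓ 2πi t` with a root `ω` of `q_n` and an index `t`
(`IsEdgeForm.exists_phase_eq`). Near an explicit point `center` this is a fixed point equation
`w = f(w)` for a holomorphic function `f` that is small on a disc of radius `2`, hence, by Cauchy's
estimate, a contraction of the unit disc (`exists_unique_fixedPoint`). Its unique fixed point tends
to `0` as `t → ∞`, which gives the asymptotics, and the derivative of `w - f(w)` does not vanish, which
gives simplicity (`IsEdgeForm.exists_zero_sequence`). Conversely, every far zero in the strip with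
index `t` lies within distance `1` of `center`, so it is this fixed point
(`IsEdgeForm.eventually_near_center`). The remaining zeros lie in a disc and are finite in number
(`exists_multiset_count`).
-/

namespace PointInteraction

/-! ### Degrees of the coefficients of `D` and the sizes of `Y` -/

section Combinatorics

variable {N : ℕ} {a : Fin N → ℂ} {Y : Fin N → E3}

theorem alpha_eq_neg_sum (Y : Fin N → E3) (σ : Equiv.Perm (Fin N)) :
    alpha Y σ = -∑ j, ‖Y j - Y (σ j)‖ := by
  rw [alpha, Finset.sum_filter_of_ne]
  intro j _ hj h
  simp [h] at hj

theorem alpha_nonpos (Y : Fin N → E3) (σ : Equiv.Perm (Fin N)) : alpha Y σ ≤ 0 := by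
  rw [alpha_eq_neg_sum]
  exact neg_nonpos.2 (Finset.sum_nonneg fun _ _ => norm_nonneg _)

theorem alpha_one (Y : Fin N → E3) : alpha Y 1 = 0 := by
  simp [alpha_eq_neg_sum]

theorem alpha_eq_zero_iff (hY : Function.Injective Y) {σ : Equiv.Perm (Fin N)} :
    alpha Y σ = 0 ↔ σ = 1 := by
  refine ⟨fun h => ?_, fun h => h ▸ alpha_one Y⟩
  rw [alpha_eq_neg_sum, neg_eq_zero, Finset.sum_eq_zero_iff_of_nonneg fun _ _ => norm_nonneg _] at h
  ext j : 1
  have := h j (Finset.mem_univ j)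
  rw [norm_eq_zero, sub_eq_zero] at this
  exact (hY this).symm

theorem finite_permSums (Y : Fin N → E3) (m : ℕ) :
    {x : ℝ | ∃ σ : Equiv.Perm (Fin N),
      (Finset.univ.filter fun j => σ j ≠ j).card = m ∧ x = ∑ j, ‖Y j - Y (σ j)‖}.Finite := by
  refine (Set.finite_range fun σ : Equiv.Perm (Fin N) => ∑ j, ‖Y j - Y (σ j)‖).subset ?_
  rintro x ⟨σ, -, rfl⟩
  exact ⟨σ, rfl⟩

theorem neg_size_le_alpha (Y : Fin N → E3) (σ : Equiv.Perm (Fin N)) :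
    -size Y σ.support.card ≤ alpha Y σ := by
  rw [size, if_neg σ.card_support_ne_one, alpha_eq_neg_sum, neg_le_neg_iff]
  exact le_csSup (finite_permSums Y _).bddAbove ⟨σ, rfl, rfl⟩

theorem size_zero (Y : Fin N → E3) : size Y 0 = 0 := by
  have : {x : ℝ | ∃ σ : Equiv.Perm (Fin N),
      (Finset.univ.filter fun j => σ j ≠ j).card = 0 ∧ x = ∑ j, ‖Y j - Y (σ j)‖} = {0} := by
    ext x
    simp only [Set.mem_ofPred_eq, Set.mem_singleton_iff]
    constructor
    · rintro ⟨σ, hσ, rfl⟩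
      rw [Finset.card_eq_zero, Finset.filter_eq_empty_iff] at hσ
      refine Finset.sum_eq_zero fun j _ => ?_
      rw [not_not.1 (hσ (Finset.mem_univ j)), sub_self, norm_zero]
    · rintro rfl
      exact ⟨1, by simp, by simp⟩
  rw [size, if_neg (by norm_num), this, csSup_singleton]

theorem sum_swap (Y : Fin N → E3) {i j : Fin N} (hij : i ≠ j) :
    ∑ k, ‖Y k - Y (Equiv.swap i j k)‖ = 2 * ‖Y i - Y j‖ := by
  rw [← Finset.sum_subset (Finset.subset_univ {i, j}), Finset.sum_pair hij]
  · rw [Equiv.swap_apply_left, Equiv.swap_apply_right, norm_sub_rev (Y j)]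
    ring
  · intro k _ hk
    simp only [Finset.mem_insert, Finset.mem_singleton, not_or] at hk
    rw [Equiv.swap_apply_of_ne_of_ne hk.1 hk.2, sub_self, norm_zero]

/-- The two-point size is attained by a transposition and is twice the diameter. -/
theorem exists_swap_size_two (hN : 2 ≤ N) (Y : Fin N → E3) (hY : Function.Injective Y) :
    0 < size Y 1 ∧ size Y 2 = 2 * size Y 1 ∧
      ∃ i j : Fin N, i ≠ j ∧ alpha Y (Equiv.swap i j) = -size Y 2 := by
  have hbdd : Bornology.IsBounded (Set.range Y) := (Set.finite_range Y).isBounded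
  have hdist : ∀ i j, ‖Y i - Y j‖ ≤ size Y 1 := fun i j => by
    rw [size, if_pos rfl, ← dist_eq_norm]
    exact Metric.dist_le_diam_of_mem hbdd ⟨i, rfl⟩ ⟨j, rfl⟩
  have : Nonempty (Fin N) := ⟨⟨0, by omega⟩⟩
  obtain ⟨⟨i, j⟩, hmax⟩ := Finite.exists_max fun p : Fin N × Fin N => ‖Y p.1 - Y p.2‖
  have hdiam : size Y 1 = ‖Y i - Y j‖ := by
    refine le_antisymm ?_ (hdist i j)
    rw [size, if_pos rfl]
    refine Metric.diam_le_of_forall_dist_le (norm_nonneg _) ?_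
    rintro _ ⟨k, rfl⟩ _ ⟨l, rfl⟩
    rw [dist_eq_norm]
    exact hmax (k, l)
  have hpos : 0 < size Y 1 := by
    let k : Fin N := ⟨0, by omega⟩
    let l : Fin N := ⟨1, by omega⟩
    have hkl : k ≠ l := by simp [k, l]
    exact (norm_pos_iff.2 (sub_ne_zero.2 (hY.ne hkl))).trans_le (hdist k l)
  have hij : i ≠ j := by
    rintro rfl
    simp [hdiam] at hpos
  have htwo : size Y 2 = 2 * size Y 1 := by
    conv_lhs => rw [size, if_neg (by norm_num)]
    refine le_antisymm (csSup_le ?_ ?_) ?_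
    · exact ⟨_, Equiv.swap i j, Equiv.Perm.card_support_swap hij, rfl⟩
    · rintro x ⟨σ, hσ, rfl⟩
      obtain ⟨k, l, hkl, rfl⟩ := Equiv.Perm.card_support_eq_two.1 hσ
      rw [sum_swap Y hkl]
      linarith [hdist k l]
    · refine le_csSup (finite_permSums Y 2).bddAbove ⟨Equiv.swap i j, ?_, ?_⟩
      · exact Equiv.Perm.card_support_swap hij
      · rw [sum_swap Y hij, hdiam]
  refine ⟨hpos, htwo, i, j, hij, ?_⟩
  rw [alpha_eq_neg_sum, sum_swap Y hij, htwo, hdiam]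

theorem natDegree_prod_neg_X_sub_C {ι : Type*} (s : Finset ι) (e : ι → ℂ) :
    (∏ j ∈ s, (-X - C (e j))).natDegree = s.card ∧
      (∏ j ∈ s, (-X - C (e j))).leadingCoeff = (-1) ^ s.card := by
  have h : ∀ j, (-X - C (e j) : ℂ[X]) = C (-1) * (X + C (e j)) := fun j => by
    simp only [C_neg, C_1]
    ring
  have hd : ∀ j, (-X - C (e j) : ℂ[X]).natDegree = 1 := fun j => by
    rw [h, natDegree_C_mul (by norm_num), natDegree_X_add_C]
  have hl : ∀ j, (-X - C (e j) : ℂ[X]).leadingCoeff = -1 := fun j => by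
    rw [h, leadingCoeff_mul, leadingCoeff_C, leadingCoeff_X_add_C, mul_one]
  constructor
  · rw [natDegree_prod]
    · simp [hd]
    · intro j _ h0
      have := hd j
      simp [h0] at this
  · rw [leadingCoeff_prod]
    simp [hl]

theorem permPoly_natDegree_leadingCoeff (hY : Function.Injective Y) (σ : Equiv.Perm (Fin N)) :
    (permPoly a Y σ).natDegree = N - σ.support.card ∧
    ∃ x : ℝ, 0 < x ∧ (permPoly a Y σ).leadingCoeff =
      ((Equiv.Perm.sign σ : ℤ) : ℂ) * x * (-1) ^ (N - σ.support.card) := by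
  have hcard : (Finset.univ.filter fun j => σ j = j).card = N - σ.support.card := by
    have h := Finset.card_filter_add_card_filter_not (s := Finset.univ) fun j => σ j = j
    rw [Finset.card_univ, Fintype.card_fin] at h
    have h' : (Finset.univ.filter fun j => ¬ σ j = j).card = σ.support.card := rfl
    omega
  have hpos : 0 < ∏ j with σ j ≠ j, ‖Y j - Y (σ j)‖⁻¹ := by
    refine Finset.prod_pos fun j hj => inv_pos.2 (norm_pos_iff.2 (sub_ne_zero.2 fun h => ?_))
    exact (Finset.mem_filter.1 hj).2 (hY h).symm
  obtain ⟨h1, h2⟩ := natDegree_prod_neg_X_sub_C (Finset.univ.filter fun j => σ j = j)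
    fun j => 4 * (Real.pi : ℂ) * a j
  constructor
  · rw [permPoly, natDegree_C_mul, h1, hcard]
    refine mul_ne_zero ?_ (by exact_mod_cast hpos.ne')
    exact_mod_cast (Equiv.Perm.sign σ).ne_zero
  · refine ⟨_, hpos, ?_⟩
    rw [permPoly, leadingCoeff_mul, leadingCoeff_C, h2, hcard]

/-- A nonzero `P_b` comes from a permutation whose number of moved points bounds its degree. -/
theorem exists_perm_of_mem_freqs (hY : Function.Injective Y) {b : ℝ} (hb : b ∈ freqs a Y) :
    ∃ σ : Equiv.Perm (Fin N), alpha Y σ = b ∧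
      (freqPoly a Y b).natDegree ≤ N - σ.support.card := by
  classical
  rw [mem_freqs] at hb
  obtain ⟨σ, hσ, -⟩ := Finset.exists_ne_zero_of_sum_ne_zero hb
  obtain ⟨τ, hτ, hmax⟩ := Finset.exists_max_image
    (Finset.univ.filter fun σ : Equiv.Perm (Fin N) => alpha Y σ = b)
    (fun σ => (permPoly a Y σ).natDegree) ⟨σ, hσ⟩
  refine ⟨τ, (Finset.mem_filter.1 hτ).2, ?_⟩
  rw [freqPoly, ← (permPoly_natDegree_leadingCoeff (a := a) hY τ).1]
  refine natDegree_sum_le_of_forall_le _ _ fun ρ hρ => hmax ρ ?_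
  simpa using hρ

theorem freqPoly_zero (hY : Function.Injective Y) :
    freqPoly a Y 0 ≠ 0 ∧ (freqPoly a Y 0).natDegree = N := by
  classical
  have h : freqPoly a Y 0 = permPoly a Y 1 := by
    rw [freqPoly, Finset.filter_congr fun σ _ => alpha_eq_zero_iff hY, Finset.filter_eq']
    simp
  obtain ⟨h1, x, hx, h2⟩ := permPoly_natDegree_leadingCoeff (a := a) hY 1
  rw [h]
  refine ⟨fun h0 => ?_, by simpa using h1⟩
  rw [h0] at h2
  simp [hx.ne'] at h2

/-- At the frequency `-Size₂` only transpositions contribute to the coefficient of degree `N - 2`,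
and all with the same sign, so that nothing cancels. -/
theorem freqPoly_neg_size_two (hN : 2 ≤ N) (hY : Function.Injective Y) :
    freqPoly a Y (-size Y 2) ≠ 0 ∧ (freqPoly a Y (-size Y 2)).natDegree = N - 2 := by
  classical
  obtain ⟨hpos, htwo, i, j, hij, hα⟩ := exists_swap_size_two hN Y hY
  set F := Finset.univ.filter fun σ : Equiv.Perm (Fin N) => alpha Y σ = -size Y 2 with hF
  have hmoved : ∀ σ ∈ F, 2 ≤ σ.support.card := by
    intro σ hσ
    refine Equiv.Perm.two_le_card_support_of_ne_one fun h => ?_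
    have := (Finset.mem_filter.1 hσ).2
    rw [h, alpha_one] at this
    linarith
  have hcoeff : ∀ σ ∈ F, ∃ x : ℝ, 0 ≤ x ∧ (σ.support.card = 2 → 0 < x) ∧
      (permPoly a Y σ).coeff (N - 2) = (-1) ^ (N - 1) * x := by
    intro σ hσ
    obtain ⟨h1, x, hx, h2⟩ := permPoly_natDegree_leadingCoeff (a := a) hY σ
    have hle : σ.support.card ≤ N := by simpa using σ.support.card_le_univ
    by_cases h : σ.support.card = 2
    · refine ⟨x, hx.le, fun _ => hx, ?_⟩
      obtain ⟨k, l, hkl, rfl⟩ := Equiv.Perm.card_support_eq_two.1 h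
      rw [h] at h1 h2
      rw [← h1, coeff_natDegree, h2, Equiv.Perm.sign_swap hkl,
        show N - 1 = N - 2 + 1 by omega, pow_succ]
      push_cast
      ring
    · refine ⟨0, le_rfl, fun h' => absurd h' h, ?_⟩
      have := hmoved σ hσ
      rw [coeff_eq_zero_of_natDegree_lt (by omega)]
      simp
  choose! x hx0 hxpos hx using hcoeff
  have hswap : Equiv.swap i j ∈ F := Finset.mem_filter.2 ⟨Finset.mem_univ _, hα⟩
  have hsum : (freqPoly a Y (-size Y 2)).coeff (N - 2) =
      (-1) ^ (N - 1) * ((∑ σ ∈ F, x σ : ℝ) : ℂ) := by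
    rw [freqPoly, finsetSum_coeff, Complex.ofReal_sum, Finset.mul_sum]
    refine Finset.sum_congr ?_ fun σ hσ => hx σ hσ
    ext; simp [hF]
  have hne : (freqPoly a Y (-size Y 2)).coeff (N - 2) ≠ 0 := by
    rw [hsum]
    have : 0 < ∑ σ ∈ F, x σ := Finset.sum_pos' hx0
      ⟨_, hswap, hxpos _ hswap (Equiv.Perm.card_support_swap hij)⟩
    exact mul_ne_zero (pow_ne_zero _ (by norm_num)) (by exact_mod_cast this.ne')
  refine ⟨fun h => hne (by rw [h, coeff_zero]), le_antisymm ?_ (le_natDegree_of_ne_zero hne)⟩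
  rw [freqPoly]
  refine natDegree_sum_le_of_forall_le _ _ fun σ hσ => ?_
  rw [(permPoly_natDegree_leadingCoeff (a := a) hY σ).1]
  have := hmoved σ (by simpa [hF] using hσ)
  omega

end Combinatorics

/-! ### Edges of the distribution diagram -/

section Edges

/-- The slope of the line through the points `(p, deg P_p)` and `(q, deg P_q)`. -/
noncomputable def edgeSlope (P : ℝ → ℂ[X]) (p q : ℝ) : ℝ :=
  (((P q).natDegree : ℝ) - (P p).natDegree) / (q - p)

/-- The segment from `(p, deg P_p)` to `(q, deg P_q)` is an increasing edge of the distribution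
diagram of `∑ b ∈ B, P_b exp(b ζ)` that contains no further point: every other point
`(b, deg P_b)` lies strictly below the whole line through the two endpoints. -/
structure IsEdge (B : Finset ℝ) (P : ℝ → ℂ[X]) (p q : ℝ) : Prop where
  left_mem : p ∈ B
  right_mem : q ∈ B
  lt : p < q
  natDegree_lt : (P p).natDegree < (P q).natDegree
  below : ∀ b ∈ B, b ≠ p → b ≠ q →
    ((P b).natDegree : ℝ) < (P p).natDegree + edgeSlope P p q * (b - p)

/-- The points with abscissas `v 0, …, v M` are the successive vertices of the distribution diagram
of `∑ b ∈ B, P_b exp(b ζ)`, all of whose segments are increasing and contain only their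
endpoints. -/
structure IsEdgeChain (B : Finset ℝ) (P : ℝ → ℂ[X]) (M : ℕ) (v : ℕ → ℝ) : Prop where
  zero_mem : v 0 ∈ B
  isEdge : ∀ n, 1 ≤ n → n ≤ M → IsEdge B P (v (n - 1)) (v n)
  zero_le : ∀ b ∈ B, v 0 ≤ b
  le_last : ∀ b ∈ B, b ≤ v M

variable {B : Finset ℝ} {P : ℝ → ℂ[X]} {p q : ℝ}

theorem IsEdge.slope_pos (h : IsEdge B P p q) : 0 < edgeSlope P p q := by
  have := h.natDegree_lt
  exact div_pos (sub_pos.2 (by exact_mod_cast this)) (sub_pos.2 h.lt)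

theorem edgeSlope_mul (h : p < q) :
    edgeSlope P p q * (q - p) = ((P q).natDegree : ℝ) - (P p).natDegree :=
  div_mul_cancel₀ _ (sub_pos.2 h).ne'

theorem IsEdge.le_line (h : IsEdge B P p q) {b : ℝ} (hb : b ∈ B) :
    ((P b).natDegree : ℝ) ≤ (P p).natDegree + edgeSlope P p q * (b - p) := by
  by_cases h1 : b = p
  · simp [h1]
  by_cases h2 : b = q
  · rw [h2, edgeSlope_mul h.lt]
    linarith
  · exact (h.below b hb h1 h2).le

variable {M : ℕ} {v : ℕ → ℝ}

theorem IsEdgeChain.mem (h : IsEdgeChain B P M v) {n : ℕ} (hn : n ≤ M) : v n ∈ B := by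
  rcases Nat.eq_zero_or_pos n with rfl | h0
  · exact h.zero_mem
  · exact (h.isEdge n h0 hn).right_mem

theorem IsEdgeChain.vertex_lt (h : IsEdgeChain B P M v) {n : ℕ} (hn : n < M) : v n < v (n + 1) := by
  simpa using (h.isEdge (n + 1) (by omega) hn).lt

theorem IsEdgeChain.slope_lt (h : IsEdgeChain B P M v) {n : ℕ} (h1 : 1 ≤ n) (hn : n < M) :
    edgeSlope P (v n) (v (n + 1)) < edgeSlope P (v (n - 1)) (v n) := by
  have hlt := (h.isEdge n h1 hn.le).lt
  have hlt' := h.vertex_lt hn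
  have hb := (h.isEdge n h1 hn.le).below _ (h.mem (n := n + 1) hn) (hlt.trans hlt').ne' hlt'.ne'
  have h2 := edgeSlope_mul (P := P) hlt
  rw [edgeSlope, div_lt_iff₀ (sub_pos.2 hlt')]
  linarith

theorem IsEdgeChain.slope_strictAnti (h : IsEdgeChain B P M v) {m n : ℕ} (h1 : 1 ≤ m) (hmn : m < n)
    (hn : n ≤ M) : edgeSlope P (v (n - 1)) (v n) < edgeSlope P (v (m - 1)) (v m) := by
  induction n, hmn using Nat.le_induction with
  | base => simpa using h.slope_lt h1 hn
  | succ k hk ih =>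
    have := h.slope_lt (n := k) (by omega) (by omega)
    simp only [Nat.add_sub_cancel]
    exact this.trans (ih (by omega))

end Edges

section Diagram

variable {N M : ℕ} {a : Fin N → ℂ} {Y : Fin N → E3} {v : ℕ → ℝ}

theorem IsEdgeChain.nonempty_diagram (h : IsEdgeChain (freqs a Y) (freqPoly a Y) M v) :
    Nonempty (DistributionDiagram a Y) :=
  ⟨{ M := M
     vertex := v
     vertex_mem := fun _ hn => h.mem hn
     vertex_zero := h.zero_le
     vertex_last := h.le_last
     vertex_lt := fun n h1 hn => (h.isEdge n h1 hn).lt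
     slope_lt := fun _ h1 hn => h.slope_lt h1 hn
     below := fun _ hb n h1 hn _ _ => (h.isEdge n h1 hn).le_line hb }⟩

/-- The points to the right of the left endpoint of a segment lie below the line that extends this
segment, because the diagram is concave. -/
theorem DistributionDiagram.le_line (L : DistributionDiagram a Y) {n : ℕ} (h1 : 1 ≤ n)
    (hn : n ≤ L.M) {b : ℝ} (hb : b ∈ freqs a Y) (hle : L.vertex (n - 1) ≤ b) :
    ((freqPoly a Y b).natDegree : ℝ) ≤ (freqPoly a Y (L.vertex (n - 1))).natDegree +
      L.slope n * (b - L.vertex (n - 1)) := by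
  revert h1 hle
  induction hn using Nat.decreasingInduction with
  | self => exact fun h1 hle => L.below b hb L.M h1 le_rfl hle (L.vertex_last b hb)
  | of_succ n hn ih =>
    intro h1 hle
    rcases le_total b (L.vertex n) with hbn | hbn
    · exact L.below b hb n h1 hn.le hle hbn
    · have h2 := ih (by omega) hbn
      have hs : L.slope (n + 1) < L.slope n := L.slope_lt n h1 hn
      have h3 : L.slope n * (L.vertex n - L.vertex (n - 1)) =
          ((freqPoly a Y (L.vertex n)).natDegree : ℝ) -
            (freqPoly a Y (L.vertex (n - 1))).natDegree :=
        div_mul_cancel₀ _ (sub_pos.2 (L.vertex_lt n h1 hn.le)).ne'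
      simp only [Nat.add_sub_cancel] at h2
      nlinarith

/-- A diagram whose segments contain no points besides their endpoints is the only one. -/
theorem IsEdgeChain.diagram_unique (h : IsEdgeChain (freqs a Y) (freqPoly a Y) M v)
    (L : DistributionDiagram a Y) : L.M = M ∧ ∀ n ≤ M, L.vertex n = v n := by
  have key : ∀ n, n ≤ M → n ≤ L.M → L.vertex n = v n := by
    intro n
    induction n with
    | zero =>
      intro _ _
      exact le_antisymm (L.vertex_zero _ h.zero_mem) (h.zero_le _ (L.vertex_mem 0 (by omega)))
    | succ n ih =>
      intro hM hL
      by_contra hne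
      have hn := ih (by omega) (by omega)
      have hlt : v n < L.vertex (n + 1) := hn ▸ L.vertex_lt (n + 1) (by omega) hL
      have h1 := (h.isEdge (n + 1) (by omega) hM).below _ (L.vertex_mem _ hL) hlt.ne' hne
      have h2 := L.le_line (n := n + 1) (by omega) hL (h.mem hM)
        (by simpa [hn] using (h.vertex_lt hM).le)
      have h3 := edgeSlope_mul (P := freqPoly a Y) (h.vertex_lt hM)
      have h4 := edgeSlope_mul (P := freqPoly a Y) hlt
      have h5 : L.slope (n + 1) = edgeSlope (freqPoly a Y) (v n) (L.vertex (n + 1)) := by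
        simp [DistributionDiagram.slope, edgeSlope, hn]
      rw [h5] at h2
      simp only [Nat.add_sub_cancel, hn] at h1 h2
      have h6 : edgeSlope (freqPoly a Y) (v n) (L.vertex (n + 1)) <
          edgeSlope (freqPoly a Y) (v n) (v (n + 1)) := by
        refine lt_of_mul_lt_mul_right ?_ (sub_pos.2 hlt).le
        linarith
      have h7 := mul_lt_mul_of_pos_right h6 (sub_pos.2 (h.vertex_lt hM))
      linarith
  have hMM : L.M = M := by
    rcases lt_trichotomy L.M M with hlt | heq | hlt
    · have h1 := L.vertex_last _ (h.mem (n := L.M + 1) hlt)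
      rw [key _ hlt.le le_rfl] at h1
      exact absurd (h.vertex_lt hlt) h1.not_gt
    · exact heq
    · have h1 := h.le_last _ (L.vertex_mem (M + 1) hlt)
      rw [← key _ le_rfl hlt.le] at h1
      have h2 := L.vertex_lt (M + 1) (by omega) hlt
      simp only [Nat.add_sub_cancel] at h2
      exact absurd h2 h1.not_gt
  exact ⟨hMM, fun n hn => key n hn (by omega)⟩

end Diagram

/-! ### The diagram under the assumptions on the sizes -/

section Sizes

/-- A sequence whose increments decrease lies strictly below the lines that extend its increments:
the form in which the concavity of `m ↦ Size_m` is used. As `s 0 = 0` and `s 2 = 2 * s 1`, the first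
two increments agree, and for `k = 1` the indices `0`, `1`, `2` are on one line. -/
theorem concave_sequence_below {s : ℕ → ℝ} {N : ℕ} (h0 : s 0 = 0) (h1 : 0 < s 1)
    (h2 : s 2 = 2 * s 1)
    (hs : ∀ m, 2 ≤ m → m ≤ N - 1 → s (m + 1) - s m < s m - s (m - 1) ∧ 0 < s (m + 1) - s m) :
    (∀ m, m < N → 0 < s (m + 1) - s m) ∧
    ∀ k m, 1 ≤ k → k < N → m ≤ N → m ≠ 1 → m ≠ k + 1 → m ≠ k → (k = 1 → m ≠ 0) →
      s m + ((k : ℝ) + 1 - m) * (s (k + 1) - s k) < s (k + 1) := by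
  have hpos : ∀ m, m < N → 0 < s (m + 1) - s m := by
    intro m hm
    rcases m with _ | _ | m
    · simpa [h0] using h1
    · simp only [zero_add, Nat.reduceAdd, h2]
      linarith
    · exact (hs _ (by omega) (by omega)).2
  have hanti : ∀ m, 1 ≤ m → m + 1 < N → s (m + 1 + 1) - s (m + 1) < s (m + 1) - s m := by
    intro m hm1 hm
    exact (hs (m + 1) (by omega) (by omega)).1
  -- indices to the left of the increment
  have hleft : ∀ m k, 1 ≤ m → m < k → k < N →
      ((k : ℝ) - m) * (s (k + 1) - s k) < s k - s m := by
    intro m k hm hmk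
    induction k, hmk using Nat.le_induction with
    | base =>
      intro hN
      have := hanti m hm hN
      push_cast
      linarith
    | succ k hk ih =>
      intro hN
      have h3 := ih (by omega)
      have h4 := hanti k (by omega) hN
      have h5 : (1 : ℝ) ≤ k + 1 - m := by
        have : (m : ℝ) ≤ k := by exact_mod_cast (by omega : m ≤ k)
        linarith
      push_cast
      nlinarith
  have hincr : ∀ k m, 1 ≤ k → k < m → m < N → s (m + 1) - s m < s (k + 1) - s k := by
    intro k m hk hkm
    induction m, hkm using Nat.le_induction with
    | base => exact hanti k hk
    | succ m hm ih => exact fun hN => (hanti m (by omega) hN).trans (ih (by omega))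
  -- indices to the right of the increment
  have hright : ∀ k m, 1 ≤ k → k + 1 < m → m ≤ N →
      s m - s (k + 1) < ((m : ℝ) - k - 1) * (s (k + 1) - s k) := by
    intro k m hk hkm
    induction m, hkm using Nat.le_induction with
    | base =>
      intro hN
      have := hanti k hk hN
      push_cast
      linarith
    | succ m hm ih =>
      intro hN
      have h3 := ih (by omega)
      have h4 := hincr k m hk (by omega) hN
      push_cast
      linarith
  refine ⟨hpos, fun k m hk hkN hmN hm1 hmk1 hmk hk1 => ?_⟩
  rcases lt_or_gt_of_ne hmk with hlt | hgt
  · rcases Nat.eq_zero_or_pos m with rfl | hm0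
    · have hk2 : 1 < k := by
        rcases hk.lt_or_eq with h | h
        · exact h
        · exact absurd rfl (hk1 h.symm)
      have h3 := hleft 1 k le_rfl hk2 hkN
      have h4 := hincr 1 k le_rfl hk2 hkN
      push_cast at h3 ⊢
      simp only [Nat.reduceAdd, h2] at h4
      rw [h0]
      linarith
    · have := hleft m k hm0 hlt hkN
      linarith
  · have := hright k m hk (by omega) hmN
    linarith

variable {N : ℕ} {a : Fin N → ℂ} {Y : Fin N → E3}

/-- The vertices of the distribution diagram from left to right: `-Size_N < ⋯ < -Size_2 < 0`. -/
noncomputable def sizeVertex (Y : Fin N → E3) (n : ℕ) : ℝ :=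
  if n + 1 < N then -size Y (N - n) else 0

theorem sizeVertex_isEdgeChain (hN : 2 ≤ N) (hY : Function.Injective Y)
    (hA3 : ∀ n : ℕ, 3 ≤ n → n ≤ N → freqPoly a Y (-size Y n) ≠ 0 ∧
      (freqPoly a Y (-size Y n)).natDegree = N - n)
    (hA4 : ∀ m : ℕ, 2 ≤ m → m ≤ N - 1 →
      size Y (m + 1) - size Y m < size Y m - size Y (m - 1) ∧ 0 < size Y (m + 1) - size Y m) :
    IsEdgeChain (freqs a Y) (freqPoly a Y) (N - 1) (sizeVertex Y) ∧
    (∀ n, n + 1 < N → (freqPoly a Y (sizeVertex Y n)).natDegree = n) ∧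
    (freqPoly a Y (sizeVertex Y (N - 1))).natDegree = N ∧
    ∀ k, 1 ≤ k → k < N → edgeSlope (freqPoly a Y) (sizeVertex Y (N - k - 1)) (sizeVertex Y (N - k)) =
      1 / (size Y (k + 1) - size Y k) := by
  obtain ⟨hs1, hs2, -⟩ := exists_swap_size_two hN Y hY
  obtain ⟨hpos, hbelow⟩ := concave_sequence_below (size_zero Y) hs1 hs2 hA4
  have hmono : ∀ m n, m ≤ n → n ≤ N → size Y m ≤ size Y n := by
    intro m n hmn
    induction n, hmn using Nat.le_induction with
    | base => exact fun _ => le_rfl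
    | succ n hn ih => exact fun h => by linarith [ih (by omega), hpos n h]
  have hfreq : ∀ m, m ≤ N → m ≠ 1 → freqPoly a Y (-size Y m) ≠ 0 ∧
      (freqPoly a Y (-size Y m)).natDegree = N - m := by
    intro m hm hm1
    rcases (by omega : m = 0 ∨ m = 2 ∨ 3 ≤ m) with rfl | rfl | h3
    · rw [size_zero, neg_zero]
      simpa using freqPoly_zero hY
    · exact freqPoly_neg_size_two hN hY
    · exact hA3 m h3 hm
  have hv1 : ∀ n, n + 1 < N → sizeVertex Y n = -size Y (N - n) := fun n hn => if_pos hn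
  have hv2 : sizeVertex Y (N - 1) = 0 := if_neg (by omega)
  have hdeg1 : ∀ n, n + 1 < N → (freqPoly a Y (sizeVertex Y n)).natDegree = n := by
    intro n hn
    rw [hv1 n hn, (hfreq (N - n) (by omega) (by omega)).2]
    omega
  have hdeg2 : (freqPoly a Y (sizeVertex Y (N - 1))).natDegree = N := by
    rw [hv2]; exact (freqPoly_zero hY).2
  have hslope : ∀ k, 1 ≤ k → k < N →
      edgeSlope (freqPoly a Y) (sizeVertex Y (N - k - 1)) (sizeVertex Y (N - k)) =
        1 / (size Y (k + 1) - size Y k) := by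
    intro k hk hkN
    have hl : sizeVertex Y (N - k - 1) = -size Y (k + 1) := by
      rw [hv1 _ (by omega)]
      congr 2
      omega
    rw [edgeSlope, hdeg1 (N - k - 1) (by omega), hl]
    rcases hk.lt_or_eq with h | rfl
    · rw [hdeg1 (N - k) (by omega), hv1 (N - k) (by omega), show N - (N - k) = k by omega,
        show N - k = N - k - 1 + 1 by omega]
      push_cast
      congr 1 <;> ring
    · rw [hdeg2, hv2]
      have h1 : ((N - 1 - 1 : ℕ) : ℝ) = N - 2 := by
        rw [show N - 1 - 1 = N - 2 by omega, Nat.cast_sub hN]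
        norm_num
      rw [h1, show (1 : ℕ) + 1 = 2 from rfl, hs2]
      field_simp
      ring
  have hmem : ∀ n, n ≤ N - 1 → sizeVertex Y n ∈ freqs a Y := by
    intro n hn
    rw [mem_freqs]
    by_cases h : n + 1 < N
    · rw [hv1 n h]; exact (hfreq _ (by omega) (by omega)).1
    · rw [show n = N - 1 by omega, hv2]; exact (freqPoly_zero hY).1
  refine ⟨⟨hmem 0 (by omega), ?_, ?_, ?_⟩, hdeg1, hdeg2, hslope⟩
  · intro n hn1 hn
    obtain ⟨k, hk, hkN, rfl⟩ : ∃ k, 1 ≤ k ∧ k < N ∧ n = N - k := ⟨N - n, by omega, by omega, by omega⟩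
    have hΔ := hpos k hkN
    have hl : sizeVertex Y (N - k - 1) = -size Y (k + 1) := by
      rw [hv1 _ (by omega)]
      congr 2
      omega
    have hr : 1 < k → sizeVertex Y (N - k) = -size Y k := fun h => by
      rw [hv1 (N - k) (by omega), show N - (N - k) = k by omega]
    refine ⟨hmem _ (by omega), hmem _ hn, ?_, ?_, ?_⟩
    · rcases hk.lt_or_eq with h | rfl
      · rw [hl, hr h]; linarith
      · rw [hl, hv2, show (1 : ℕ) + 1 = 2 from rfl]; linarith
    · rw [hdeg1 (N - k - 1) (by omega)]
      rcases hk.lt_or_eq with h | rfl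
      · rw [hdeg1 (N - k) (by omega)]; omega
      · rw [hdeg2]; omega
    · intro b hb hbl hbr
      rw [hslope k hk hkN, hdeg1 (N - k - 1) (by omega)]
      rw [hl] at hbl ⊢
      obtain ⟨σ, hσ, hd⟩ := exists_perm_of_mem_freqs hY hb
      have hm1 := σ.card_support_ne_one
      have hmN : σ.support.card ≤ N := by simpa using σ.support.card_le_univ
      have hbm := neg_size_le_alpha Y σ
      rw [hσ] at hbm
      have hk1 : k = 1 → σ.support.card ≠ 0 := by
        rintro rfl h
        rw [Finset.card_eq_zero, Equiv.Perm.support_eq_empty_iff] at h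
        rw [hv2] at hbr
        exact hbr (by rw [← hσ, h, alpha_one])
      set m := σ.support.card
      have hd' : ((freqPoly a Y b).natDegree : ℝ) ≤ N - m := by
        rw [← Nat.cast_sub hmN]; exact_mod_cast hd
      have hcast : ((N - k - 1 : ℕ) : ℝ) = N - k - 1 := by
        rw [show N - k - 1 = N - (k + 1) by omega, Nat.cast_sub (by omega)]
        push_cast; ring
      rw [hcast]
      -- multiply by the increment of the size
      suffices h : ((k : ℝ) + 1 - m) * (size Y (k + 1) - size Y k) < b + size Y (k + 1) by
        have h3 : (k : ℝ) + 1 - m < 1 / (size Y (k + 1) - size Y k) * (b - -size Y (k + 1)) := by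
          rw [one_div_mul_eq_div, lt_div_iff₀ hΔ]
          linarith
        linarith
      by_cases hmk1 : m = k + 1
      · rw [hmk1] at hbm ⊢
        have : -size Y (k + 1) < b := lt_of_le_of_ne hbm (Ne.symm hbl)
        push_cast
        linarith
      by_cases hmk : m = k
      · rw [hmk] at hbm ⊢
        have : -size Y k < b := lt_of_le_of_ne hbm fun h => hbr (by rw [hr (by omega), h])
        linarith
      · linarith [hbelow k m hk hkN hmN hm1 hmk1 hmk hk1]
  · intro b hb
    obtain ⟨σ, hσ, -⟩ := exists_perm_of_mem_freqs hY hb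
    have hmN : σ.support.card ≤ N := by simpa using σ.support.card_le_univ
    have hbm := neg_size_le_alpha Y σ
    rw [hσ] at hbm
    rw [hv1 0 (by omega), Nat.sub_zero]
    linarith [hmono _ N hmN le_rfl]
  · intro b hb
    obtain ⟨σ, hσ, -⟩ := exists_perm_of_mem_freqs hY hb
    rw [hv2, ← hσ]
    exact alpha_nonpos Y σ

end Sizes

/-! ### Exponential polynomials: dominant terms and logarithmic strips -/

section Strips

open Filter Topology Bornology

/-- The exponential polynomial `∑ b ∈ B, P_b(ζ) exp(b ζ)`. -/
noncomputable def expPoly (B : Finset ℝ) (P : ℝ → ℂ[X]) (ζ : ℂ) : ℂ :=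
  ∑ b ∈ B, (P b).eval ζ * Complex.exp ((b : ℂ) * ζ)

/-- The curvilinear strip `|Re ζ + μ log |ζ|| ≤ C`, on which `ζ exp(ζ / μ)` has modulus bounded
above and below. -/
def strip (μ C : ℝ) : Set ℂ := {ζ | |ζ.re + μ * Real.log ‖ζ‖| ≤ C}

/-- The ratio between `∑ b, P_b(ζ) exp(b ζ)` without the leading monomial at `q` and the leading
monomial at `p`. -/
noncomputable def edgeRatio (B : Finset ℝ) (P : ℝ → ℂ[X]) (p q : ℝ) (ζ : ℂ) : ℂ :=
  (expPoly B P ζ - (P q).leadingCoeff * ζ ^ (P q).natDegree * Complex.exp ((q : ℂ) * ζ)) /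
    ((P p).leadingCoeff * ζ ^ (P p).natDegree * Complex.exp ((p : ℂ) * ζ))

theorem tendsto_eval_div_pow_natDegree (Q : ℂ[X]) :
    Tendsto (fun ζ : ℂ => Q.eval ζ / ζ ^ Q.natDegree) (cobounded ℂ) (𝓝 Q.leadingCoeff) := by
  have h : Tendsto (fun ζ : ℂ => Q.reverse.eval ζ⁻¹) (cobounded ℂ) (𝓝 (Q.reverse.eval 0)) :=
    (Q.reverse.continuous.tendsto 0).comp tendsto_inv₀_cobounded
  rw [← coeff_zero_eq_eval_zero, coeff_zero_reverse] at h
  refine h.congr' ?_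
  filter_upwards [eventually_ne_cobounded 0] with ζ hζ
  have : Invertible ζ := invertibleOfNonzero hζ
  have h2 := eval₂_reverse_mul_pow (RingHom.id ℂ) ζ Q
  rw [invOf_eq_inv] at h2
  rw [eq_div_iff (pow_ne_zero _ hζ)]
  exact h2

theorem norm_pow_mul_exp {ζ : ℂ} (hζ : ζ ≠ 0) (d : ℕ) (b : ℝ) :
    ‖ζ ^ d * Complex.exp ((b : ℂ) * ζ)‖ = Real.exp (d * Real.log ‖ζ‖ + b * ζ.re) := by
  rw [norm_mul, norm_pow, Complex.norm_exp, Complex.re_ofReal_mul, Real.exp_add, mul_comm (d : ℝ),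
    Real.exp_mul (Real.log ‖ζ‖), Real.exp_log (norm_pos_iff.2 hζ), Real.rpow_natCast]

theorem differentiable_expPoly (B : Finset ℝ) (P : ℝ → ℂ[X]) : Differentiable ℂ (expPoly B P) := by
  unfold expPoly
  fun_prop

variable {B : Finset ℝ} {P : ℝ → ℂ[X]} {p q : ℝ}

/-- Far out in the strip that belongs to an edge, the terms of the two endpoints of this edge
dominate all other terms. -/
theorem IsEdge.tendsto_edgeRatio (h : IsEdge B P p q) (hP : P p ≠ 0) (C : ℝ) :
    Tendsto (edgeRatio B P p q) (cobounded ℂ ⊓ 𝓟 (strip (edgeSlope P p q) C)) (𝓝 1) := by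
  classical
  set μ := edgeSlope P p q with hμ
  set l := cobounded ℂ ⊓ 𝓟 (strip μ C) with hl
  have hlc : (P p).leadingCoeff ≠ 0 := leadingCoeff_ne_zero.2 hP
  have hco : ∀ b, Tendsto (fun ζ : ℂ => (P b).eval ζ / ζ ^ (P b).natDegree) l
      (𝓝 (P b).leadingCoeff) := fun b => (tendsto_eval_div_pow_natDegree (P b)).mono_left inf_le_left
  have hne : ∀ᶠ ζ in l, ζ ≠ 0 := (eventually_ne_cobounded 0).filter_mono inf_le_left
  have hstrip : ∀ᶠ ζ in l, ζ ∈ strip μ C := mem_inf_of_right (mem_principal_self _)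
  have hlog : Tendsto (fun ζ : ℂ => Real.log ‖ζ‖) l atTop :=
    (Real.tendsto_log_atTop.comp tendsto_norm_cobounded_atTop).mono_left inf_le_left
  -- the quotient of the leading monomials at `b` and `p`
  let R : ℝ → ℂ → ℂ := fun b ζ => (ζ ^ (P b).natDegree * Complex.exp ((b : ℂ) * ζ)) /
    (ζ ^ (P p).natDegree * Complex.exp ((p : ℂ) * ζ))
  have hR : ∀ b, ∀ᶠ ζ in l, ‖R b ζ‖ ≤ Real.exp (-((P p).natDegree + μ * (b - p) -
      (P b).natDegree) * Real.log ‖ζ‖ + |b - p| * C) := by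
    intro b
    filter_upwards [hne, hstrip] with ζ hζ hs
    rw [norm_div, norm_pow_mul_exp hζ, norm_pow_mul_exp hζ, ← Real.exp_sub]
    refine Real.exp_le_exp.2 ?_
    have h1 : (b - p) * (ζ.re + μ * Real.log ‖ζ‖) ≤ |b - p| * C :=
      (le_abs_self _).trans (by
        rw [abs_mul]
        exact mul_le_mul_of_nonneg_left hs (abs_nonneg _))
    linarith
  have hterm : ∀ b ∈ B, Tendsto (fun ζ => ((P b).eval ζ / ζ ^ (P b).natDegree -
      if b = q then (P q).leadingCoeff else 0) * (R b ζ / (P p).leadingCoeff)) l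
      (𝓝 (if b = p then 1 else 0)) := by
    intro b hb
    by_cases hbp : b = p
    · subst hbp
      have h1 : (if b = q then (P q).leadingCoeff else 0) = 0 := if_neg h.lt.ne
      have h2 : ∀ᶠ ζ in l, R b ζ = 1 := by
        filter_upwards [hne] with ζ hζ
        exact div_self (mul_ne_zero (pow_ne_zero _ hζ) (Complex.exp_ne_zero _))
      have h3 := (hco b).mul (tendsto_const_nhds (x := 1 / (P b).leadingCoeff))
      rw [mul_one_div_cancel hlc] at h3
      rw [if_pos rfl, h1]
      refine h3.congr' ?_
      filter_upwards [h2] with ζ h2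
      rw [h2, sub_zero]
    · rw [if_neg hbp]
      by_cases hbq : b = q
      · subst hbq
        simp only [if_true]
        have h1 : Tendsto (fun ζ => (P b).eval ζ / ζ ^ (P b).natDegree - (P b).leadingCoeff) l
            (𝓝 0) := by simpa using (hco b).sub_const (P b).leadingCoeff
        refine h1.zero_mul_isBoundedUnder_le
          ⟨Real.exp (|b - p| * C) / ‖(P p).leadingCoeff‖, ?_⟩
        rw [eventually_map]
        filter_upwards [hR b] with ζ h2
        rw [Function.comp_apply, norm_div]
        gcongr
        refine h2.trans_eq ?_
        rw [hμ, edgeSlope_mul h.lt]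
        congr 1
        ring
      · simp only [if_neg hbq, sub_zero]
        have h1 : Tendsto (R b) l (𝓝 0) := by
          refine squeeze_zero_norm' (hR b) (Real.tendsto_exp_atBot.comp ?_)
          refine tendsto_atBot_add_const_right _ _ (hlog.const_mul_atTop_of_neg ?_)
          have := h.below b hb hbp hbq
          linarith
        simpa using (hco b).mul (h1.div_const (P p).leadingCoeff)
  have hsum := tendsto_finsetSum B hterm
  rw [Finset.sum_ite_eq' B p, if_pos h.left_mem] at hsum
  refine hsum.congr' ?_
  filter_upwards [hne] with ζ hζ
  have hp0 : ζ ^ (P p).natDegree * Complex.exp ((p : ℂ) * ζ) ≠ 0 :=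
    mul_ne_zero (pow_ne_zero _ hζ) (Complex.exp_ne_zero _)
  have hq : (P q).leadingCoeff * ζ ^ (P q).natDegree * Complex.exp ((q : ℂ) * ζ) =
      ∑ b ∈ B, (if b = q then (P q).leadingCoeff else 0) *
        (ζ ^ (P b).natDegree * Complex.exp ((b : ℂ) * ζ)) := by
    simp only [ite_mul, zero_mul]
    rw [Finset.sum_ite_eq' B q, if_pos h.right_mem, mul_assoc]
  rw [edgeRatio, hq, expPoly, ← Finset.sum_sub_distrib, Finset.sum_div]
  refine Finset.sum_congr rfl fun b _ => ?_
  simp only [R]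
  have hb0 := pow_ne_zero (P b).natDegree hζ
  have hp1 := pow_ne_zero (P p).natDegree hζ
  have he := Complex.exp_ne_zero ((p : ℂ) * ζ)
  field_simp

variable {M : ℕ} {v : ℕ → ℝ}

/-- Outside the strips that belong to the edges, the term of a single vertex dominates. -/
theorem IsEdgeChain.exists_strip (h : IsEdgeChain B P M v) (hP : ∀ b ∈ B, P b ≠ 0) :
    ∃ C R : ℝ, ∀ ζ : ℂ, R ≤ ‖ζ‖ → expPoly B P ζ = 0 →
      ∃ n, 1 ≤ n ∧ n ≤ M ∧ ζ ∈ strip (edgeSlope P (v (n - 1)) (v n)) C := by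
  classical
  have hsmall : ∀ᶠ C in atTop, ∀ b₀ ∈ B,
      ∑ b ∈ B.erase b₀, (‖(P b).leadingCoeff‖ + 1) * Real.exp (-(|b - b₀| * C)) <
        ‖(P b₀).leadingCoeff‖ / 2 := by
    rw [eventually_all_finset]
    intro b₀ hb₀
    have hpos : 0 < ‖(P b₀).leadingCoeff‖ / 2 :=
      half_pos (norm_pos_iff.2 (leadingCoeff_ne_zero.2 (hP b₀ hb₀)))
    refine Tendsto.eventually_lt_const (v := 0) hpos ?_
    rw [← Finset.sum_const_zero (s := B.erase b₀)]
    refine tendsto_finsetSum _ fun b hb => ?_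
    have h1 : Tendsto (fun C : ℝ => Real.exp (-(|b - b₀| * C))) atTop (𝓝 0) :=
      Real.tendsto_exp_neg_atTop_nhds_zero.comp
        (tendsto_id.const_mul_atTop (abs_pos.2 (sub_ne_zero.2 (Finset.ne_of_mem_erase hb))))
    simpa using h1.const_mul (‖(P b).leadingCoeff‖ + 1)
  obtain ⟨C, hC⟩ := hsmall.exists
  have hlarge : ∀ᶠ ζ in cobounded ℂ, 1 ≤ ‖ζ‖ ∧ ∀ b ∈ B,
      ‖(P b).leadingCoeff‖ / 2 < ‖(P b).eval ζ / ζ ^ (P b).natDegree‖ ∧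
        ‖(P b).eval ζ / ζ ^ (P b).natDegree‖ < ‖(P b).leadingCoeff‖ + 1 := by
    refine (eventually_cobounded_le_norm 1).and ?_
    rw [eventually_all_finset]
    intro b hb
    have h1 := (tendsto_eval_div_pow_natDegree (P b)).norm
    have hpos : 0 < ‖(P b).leadingCoeff‖ := norm_pos_iff.2 (leadingCoeff_ne_zero.2 (hP b hb))
    exact (h1.eventually_const_lt (half_lt_self hpos)).and (h1.eventually_lt_const (lt_add_one _))
  obtain ⟨R, -, hR⟩ := (hasBasis_cobounded_norm (E := ℂ)).eventually_iff.1 hlarge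
  refine ⟨C, R, fun ζ hζR hζ0 => ?_⟩
  by_contra! hns
  obtain ⟨h1, hb⟩ := hR hζR
  have hζ : ζ ≠ 0 := fun h0 => by norm_num [h0] at h1
  have hlog : 0 ≤ Real.log ‖ζ‖ := Real.log_nonneg h1
  set σ : ℕ → ℝ := fun n => ζ.re + edgeSlope P (v (n - 1)) (v n) * Real.log ‖ζ‖ with hσ
  have hσabs : ∀ n, 1 ≤ n → n ≤ M → C < |σ n| := fun n hn1 hn => not_le.1 (hns n hn1 hn)
  -- the dominant vertex: the line `σ` changes sign there
  obtain ⟨n, hnM, hnl, hnr⟩ : ∃ n ≤ M, (1 ≤ n → C < σ n) ∧ (n < M → σ (n + 1) < -C) := by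
    refine ⟨Nat.findGreatest (fun n => C < σ n) M, Nat.findGreatest_le M, fun h0 => ?_, fun hlt => ?_⟩
    · exact Nat.findGreatest_of_ne_zero (P := fun n => C < σ n) rfl (by omega)
    · have h2 := Nat.findGreatest_is_greatest (P := fun n => C < σ n) (Nat.lt_succ_self _) hlt
      rcases lt_abs.1 (hσabs _ (by omega) hlt) with h3 | h3
      · exact absurd h3 h2
      · linarith
  have hmem := h.mem hnM
  set b₀ := v n with hb₀
  have hheight : ∀ b ∈ B.erase b₀, (P b).natDegree * Real.log ‖ζ‖ + b * ζ.re ≤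
      ((P b₀).natDegree * Real.log ‖ζ‖ + b₀ * ζ.re) + -(|b - b₀| * C) := by
    intro b hbB
    obtain ⟨hbne, hbB⟩ := Finset.mem_erase.1 hbB
    rcases lt_or_gt_of_ne hbne with hlt | hgt
    · have hn1 : 1 ≤ n := by
        by_contra h0
        have := h.zero_le b hbB
        rw [hb₀, show n = 0 by omega] at hlt
        exact this.not_gt hlt
      have h2 := (h.isEdge n hn1 hnM).le_line hbB
      have h3 := edgeSlope_mul (P := P) (h.isEdge n hn1 hnM).lt
      have h4 : ((P b).natDegree : ℝ) ≤ (P b₀).natDegree +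
          edgeSlope P (v (n - 1)) (v n) * (b - b₀) := by
        rw [hb₀]; linarith
      have h5 := mul_le_mul_of_nonneg_right h4 hlog
      have h6 := mul_le_mul_of_nonneg_left (hnl hn1).le (sub_pos.2 hlt).le
      rw [abs_of_neg (sub_neg.2 hlt)]
      simp only [hσ] at h6
      linarith
    · have hnM' : n < M := by
        by_contra h0
        have := h.le_last b hbB
        rw [hb₀, show n = M by omega] at hgt
        exact this.not_gt hgt
      have h4 := (h.isEdge (n + 1) (by omega) hnM').le_line hbB
      simp only [Nat.add_sub_cancel] at h4
      have h5 := mul_le_mul_of_nonneg_right h4 hlog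
      have h6 := mul_le_mul_of_nonneg_left (hnr hnM').le (sub_pos.2 hgt).le
      rw [abs_of_pos (sub_pos.2 hgt)]
      simp only [hσ, Nat.add_sub_cancel] at h6
      rw [hb₀] at h6 ⊢
      linarith
  have hnorm : ∀ b, ‖(P b).eval ζ * Complex.exp ((b : ℂ) * ζ)‖ =
      ‖(P b).eval ζ / ζ ^ (P b).natDegree‖ *
        Real.exp ((P b).natDegree * Real.log ‖ζ‖ + b * ζ.re) := by
    intro b
    rw [← norm_pow_mul_exp hζ, ← norm_mul]
    congr 1
    have := pow_ne_zero (P b).natDegree hζ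
    field_simp
  set E := Real.exp ((P b₀).natDegree * Real.log ‖ζ‖ + b₀ * ζ.re) with hE
  have hEpos : 0 < E := Real.exp_pos _
  have hlow : ‖(P b₀).leadingCoeff‖ / 2 * E ≤ ‖(P b₀).eval ζ * Complex.exp ((b₀ : ℂ) * ζ)‖ := by
    rw [hnorm]
    exact mul_le_mul_of_nonneg_right (hb b₀ hmem).1.le hEpos.le
  have hupp : ∀ b ∈ B.erase b₀, ‖(P b).eval ζ * Complex.exp ((b : ℂ) * ζ)‖ ≤
      (‖(P b).leadingCoeff‖ + 1) * Real.exp (-(|b - b₀| * C)) * E := by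
    intro b hbB
    rw [hnorm, mul_assoc, mul_comm (Real.exp (-(|b - b₀| * C))), hE, ← Real.exp_add]
    refine mul_le_mul (hb b (Finset.mem_of_mem_erase hbB)).2.le
      (Real.exp_le_exp.2 (hheight b hbB)) (Real.exp_pos _).le (by positivity)
  have hzero : (P b₀).eval ζ * Complex.exp ((b₀ : ℂ) * ζ) =
      -∑ b ∈ B.erase b₀, (P b).eval ζ * Complex.exp ((b : ℂ) * ζ) := by
    rw [eq_neg_iff_add_eq_zero, Finset.add_sum_erase B
      (fun b : ℝ => (P b).eval ζ * Complex.exp ((b : ℂ) * ζ)) hmem]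
    exact hζ0
  rw [hzero, norm_neg] at hlow
  have hfin := hlow.trans ((norm_sum_le _ _).trans (Finset.sum_le_sum hupp))
  rw [← Finset.sum_mul] at hfin
  exact (hC b₀ hmem).not_ge (le_of_mul_le_mul_right hfin hEpos)

end Strips

/-! ### The zeros near one edge -/

section EdgeZeros

open Filter Topology Bornology

/-- The function `D` has the form `A(ζ) (κ Φ(ζ) - (ζ exp(ζ / μ))^r)` off the origin, with `A` free of
zeros and `Φ → 1` in the strips with slope `μ`. Near an edge of its distribution diagram every
exponential polynomial has this form. -/
structure IsEdgeForm (D A Φ : ℂ → ℂ) (μ : ℝ) (r : ℕ) (κ : ℂ) : Prop where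
  slope_pos : 0 < μ
  mult_pos : 0 < r
  const_ne_zero : κ ≠ 0
  differentiableAt_factor : ∀ ζ ≠ 0, DifferentiableAt ℂ A ζ
  differentiableAt_ratio : ∀ ζ ≠ 0, DifferentiableAt ℂ Φ ζ
  factor_ne_zero : ∀ ζ ≠ 0, A ζ ≠ 0
  eq_mul : ∀ ζ ≠ 0, D ζ = A ζ * (κ * Φ ζ - (ζ * Complex.exp (ζ / μ)) ^ r)
  tendsto_ratio : ∀ C, Tendsto Φ (cobounded ℂ ⊓ 𝓟 (strip μ C)) (𝓝 1)

theorem IsEdge.isEdgeForm {B : Finset ℝ} {P : ℝ → ℂ[X]} {p q : ℝ} (h : IsEdge B P p q)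
    (hP : ∀ b ∈ B, P b ≠ 0) :
    IsEdgeForm (expPoly B P)
      (fun ζ => -(P q).leadingCoeff * (ζ ^ (P p).natDegree * Complex.exp ((p : ℂ) * ζ)))
      (edgeRatio B P p q) (edgeSlope P p q) ((P q).natDegree - (P p).natDegree)
      (-(P p).leadingCoeff / (P q).leadingCoeff) := by
  have hp := leadingCoeff_ne_zero.2 (hP p h.left_mem)
  have hq := leadingCoeff_ne_zero.2 (hP q h.right_mem)
  have hden : ∀ ζ : ℂ, ζ ≠ 0 →
      (P p).leadingCoeff * ζ ^ (P p).natDegree * Complex.exp ((p : ℂ) * ζ) ≠ 0 := fun ζ hζ =>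
    mul_ne_zero (mul_ne_zero hp (pow_ne_zero _ hζ)) (Complex.exp_ne_zero _)
  refine ⟨h.slope_pos, Nat.sub_pos_of_lt h.natDegree_lt, div_ne_zero (neg_ne_zero.2 hp) hq, ?_, ?_,
    ?_, ?_, h.tendsto_edgeRatio (hP p h.left_mem)⟩
  · intro ζ _
    fun_prop
  · intro ζ hζ
    have := (differentiable_expPoly B P) ζ
    unfold edgeRatio
    exact DifferentiableAt.div (by fun_prop) (by fun_prop) (hden ζ hζ)
  · intro ζ hζ
    exact mul_ne_zero (neg_ne_zero.2 hq) (mul_ne_zero (pow_ne_zero _ hζ) (Complex.exp_ne_zero _))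
  · intro ζ hζ
    have hμ : ((edgeSlope P p q : ℝ) : ℂ) ≠ 0 := by exact_mod_cast h.slope_pos.ne'
    have hr : (((P q).natDegree - (P p).natDegree : ℕ) : ℂ) * (ζ / (edgeSlope P p q : ℝ)) =
        (q : ℂ) * ζ - p * ζ := by
      have h1 := congrArg (Complex.ofReal) (edgeSlope_mul (P := P) h.lt)
      rw [Nat.cast_sub h.natDegree_lt.le]
      push_cast at h1
      field_simp
      linear_combination -h1
    have h2 : (ζ * Complex.exp (ζ / (edgeSlope P p q : ℝ))) ^
        ((P q).natDegree - (P p).natDegree) * (ζ ^ (P p).natDegree * Complex.exp ((p : ℂ) * ζ)) =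
        ζ ^ (P q).natDegree * Complex.exp ((q : ℂ) * ζ) := by
      rw [mul_pow, ← Complex.exp_nat_mul, hr, Complex.exp_sub,
        ← Nat.sub_add_cancel h.natDegree_lt.le, pow_add, Nat.add_sub_cancel]
      have := Complex.exp_ne_zero ((p : ℂ) * ζ)
      field_simp
    have h3 : edgeRatio B P p q ζ *
        ((P p).leadingCoeff * ζ ^ (P p).natDegree * Complex.exp ((p : ℂ) * ζ)) =
        expPoly B P ζ - (P q).leadingCoeff * ζ ^ (P q).natDegree * Complex.exp ((q : ℂ) * ζ) :=
      div_mul_cancel₀ _ (hden ζ hζ)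
    have h4 : -(P q).leadingCoeff * (-(P p).leadingCoeff / (P q).leadingCoeff) =
        (P p).leadingCoeff := by field_simp
    linear_combination (-(P q).leadingCoeff) * h2 - h3 -
      (edgeRatio B P p q ζ * (ζ ^ (P p).natDegree * Complex.exp ((p : ℂ) * ζ))) * h4

/-- The difference between a logarithm of `ζ exp(ζ / μ)` and a logarithm of `ω Φ(ζ)^(1 / r)`: for
`ω ^ r = κ`, the zeros are the points at which it is a multiple of `2πi`. -/
noncomputable def phase (Φ : ℂ → ℂ) (μ : ℝ) (r : ℕ) (ω ζ : ℂ) : ℂ :=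
  ζ / μ + Complex.log ζ - Complex.log ω - Complex.log (Φ ζ) / r

/-- The main part of the zero with index `t` of the sequence with parameter `ω` in the lower
(`s = 1`) or upper (`s = -1`) half plane. -/
noncomputable def center (μ s : ℝ) (ω : ℂ) (t : ℕ) : ℂ :=
  μ * (-(s * t * (2 * Real.pi * Complex.I)) - (Real.log (2 * Real.pi * μ * t) : ℝ) +
    s * (Real.pi / 2) * Complex.I + Complex.log ω)

/-- The zeros near `center μ s ω t` with index `t` are the points `center μ s ω t + w` where `w` is a
fixed point of this function. -/
noncomputable def correction (Φ : ℂ → ℂ) (μ : ℝ) (r : ℕ) (s : ℝ) (ω : ℂ) (t : ℕ) (w : ℂ) : ℂ :=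
  -μ * (Complex.log (center μ s ω t + w) - (Real.log (2 * Real.pi * μ * t) : ℝ) +
    s * (Real.pi / 2) * Complex.I - Complex.log (Φ (center μ s ω t + w)) / r)

variable {D A Φ : ℂ → ℂ} {μ s : ℝ} {r : ℕ} {κ ω : ℂ}

theorem phase_center_add (hμ : μ ≠ 0) (t : ℕ) (w : ℂ) :
    phase Φ μ r ω (center μ s ω t + w) =
      -(s * t * (2 * Real.pi * Complex.I)) + (w - correction Φ μ r s ω t w) / μ := by
  have hμ' : (μ : ℂ) ≠ 0 := by exact_mod_cast hμ
  rw [phase, correction]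
  nth_rewrite 1 [center]
  field_simp
  ring

theorem phase_eq_iff_isFixedPt (hμ : μ ≠ 0) (t : ℕ) (w : ℂ) :
    phase Φ μ r ω (center μ s ω t + w) = -(s * t * (2 * Real.pi * Complex.I)) ↔
      correction Φ μ r s ω t w = w := by
  have hμ' : (μ : ℂ) ≠ 0 := by exact_mod_cast hμ
  rw [phase_center_add hμ, add_eq_left, div_eq_zero_iff, or_iff_left hμ', sub_eq_zero, eq_comm]

theorem exp_phase {ζ : ℂ} (hζ : ζ ≠ 0) (hω : ω ≠ 0) :
    Complex.exp (phase Φ μ r ω ζ) * ω * Complex.exp (Complex.log (Φ ζ) / r) =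
      ζ * Complex.exp (ζ / μ) := by
  rw [phase, Complex.exp_sub, Complex.exp_sub, Complex.exp_add, Complex.exp_log hζ,
    Complex.exp_log hω]
  have := Complex.exp_ne_zero (Complex.log (Φ ζ) / r)
  field_simp

theorem exp_log_div_pow {z : ℂ} (hr : 0 < r) (hz : z ≠ 0) :
    Complex.exp (Complex.log z / r) ^ r = z := by
  rw [← Complex.exp_nat_mul, mul_div_cancel₀ _ (by exact_mod_cast hr.ne'), Complex.exp_log hz]

theorem exp_neg_sign_mul (hs : s = 1 ∨ s = -1) (t : ℕ) :
    Complex.exp (-(s * t * (2 * Real.pi * Complex.I))) = 1 := by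
  rw [Complex.exp_eq_one_iff]
  rcases hs with rfl | rfl
  · exact ⟨-t, by push_cast; ring⟩
  · exact ⟨t, by push_cast; ring⟩

theorem IsEdgeForm.eq_mul_one_sub_exp (h : IsEdgeForm D A Φ μ r κ) (hω : ω ^ r = κ) {ζ : ℂ}
    (hζ : ζ ≠ 0) (hΦ : Φ ζ ≠ 0) :
    D ζ = A ζ * (κ * Φ ζ) * (1 - Complex.exp (r * phase Φ μ r ω ζ)) := by
  have hω0 : ω ≠ 0 := by
    rintro rfl
    exact h.const_ne_zero (by rw [← hω, zero_pow h.mult_pos.ne'])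
  have h1 := congrArg (· ^ r) (exp_phase (Φ := Φ) (μ := μ) (r := r) hζ hω0)
  simp only [mul_pow, exp_log_div_pow h.mult_pos hΦ, hω, ← Complex.exp_nat_mul] at h1
  rw [h.eq_mul ζ hζ, mul_pow, ← Complex.exp_nat_mul]
  linear_combination (-A ζ) * h1.symm

/-- Every zero belongs to one of the roots `ω` of `κ` and one of the branches of the logarithm. -/
theorem IsEdgeForm.exists_phase_eq (h : IsEdgeForm D A Φ μ r κ) {ζ : ℂ} (hζ : ζ ≠ 0)
    (hΦ : Φ ζ ≠ 0) (hD : D ζ = 0) :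
    ∃ ω : ℂ, ω ^ r = κ ∧ ∃ s : ℝ, (s = 1 ∨ s = -1) ∧ ∃ t : ℕ,
      phase Φ μ r ω ζ = -(s * t * (2 * Real.pi * Complex.I)) := by
  rw [h.eq_mul ζ hζ, mul_eq_zero, or_iff_right (h.factor_ne_zero ζ hζ), sub_eq_zero] at hD
  set G := Complex.exp (Complex.log (Φ ζ) / r) with hG
  have hG0 : G ≠ 0 := Complex.exp_ne_zero _
  set ω := ζ * Complex.exp (ζ / μ) / G with hω
  have hω0 : ω ≠ 0 := div_ne_zero (mul_ne_zero hζ (Complex.exp_ne_zero _)) hG0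
  refine ⟨ω, ?_, ?_⟩
  · rw [hω, div_pow, ← hD, exp_log_div_pow h.mult_pos hΦ, mul_div_cancel_right₀ _ hΦ]
  · have h1 : Complex.exp (phase Φ μ r ω ζ) = 1 := by
      have h2 := exp_phase (Φ := Φ) (μ := μ) (r := r) hζ hω0
      have h3 : ω * G = ζ * Complex.exp (ζ / μ) := div_mul_cancel₀ _ hG0
      rw [mul_assoc, h3] at h2
      exact mul_eq_right₀ (mul_ne_zero hζ (Complex.exp_ne_zero _)) |>.1 h2
    obtain ⟨m, hm⟩ := Complex.exp_eq_one_iff.1 h1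
    obtain ⟨t, rfl | rfl⟩ := Int.eq_nat_or_neg m
    · exact ⟨-1, Or.inr rfl, t, by rw [hm]; push_cast; ring⟩
    · exact ⟨1, Or.inl rfl, t, by rw [hm]; push_cast; ring⟩

/-- A point determines the root, the half plane and the index of the sequence that it belongs to. -/
theorem phase_eq_unique {ω' : ℂ} {s' : ℝ} {t t' : ℕ} {ζ : ℂ} (hζ : ζ ≠ 0) (hω : ω ≠ 0)
    (hω' : ω' ≠ 0) (hs : s = 1 ∨ s = -1) (hs' : s' = 1 ∨ s' = -1) (ht : 1 ≤ t)
    (h : phase Φ μ r ω ζ = -(s * t * (2 * Real.pi * Complex.I)))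
    (h' : phase Φ μ r ω' ζ = -(s' * t' * (2 * Real.pi * Complex.I))) :
    ω = ω' ∧ s = s' ∧ t = t' := by
  have h1 := exp_phase (Φ := Φ) (μ := μ) (r := r) hζ hω
  have h2 := exp_phase (Φ := Φ) (μ := μ) (r := r) hζ hω'
  rw [h, exp_neg_sign_mul hs, one_mul] at h1
  rw [h', exp_neg_sign_mul hs', one_mul, ← h1] at h2
  have hωω := mul_right_cancel₀ (Complex.exp_ne_zero _) h2
  subst hωω
  rw [h, neg_inj] at h'
  have h3 := mul_right_cancel₀ Complex.two_pi_I_ne_zero h'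
  have h4 : s * t = s' * t' := by exact_mod_cast h3
  have ht0 : (1 : ℝ) ≤ t := by exact_mod_cast ht
  have ht0' : (0 : ℝ) ≤ t' := t'.cast_nonneg
  refine ⟨rfl, ?_⟩
  rcases hs with rfl | rfl <;> rcases hs' with rfl | rfl
  · exact ⟨rfl, by exact_mod_cast (by linarith : (t : ℝ) = t')⟩
  · linarith
  · linarith
  · exact ⟨rfl, by exact_mod_cast (by linarith : (t : ℝ) = t')⟩

theorem log_neg_sign_mul_I (hs : s = 1 ∨ s = -1) :
    Complex.log (-(s * Complex.I)) = -(s * (Real.pi / 2) * Complex.I) := by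
  rcases hs with rfl | rfl
  · rw [Complex.ofReal_one, one_mul, Complex.log_neg_I]
    ring
  · rw [Complex.ofReal_neg, Complex.ofReal_one, neg_mul, one_mul, neg_neg, Complex.log_I]
    ring

theorem neg_sign_mul_I_mem_slitPlane (hs : s = 1 ∨ s = -1) :
    -(s * Complex.I) ∈ Complex.slitPlane := by
  right
  rcases hs with rfl | rfl <;> simp

/-- If `Z / x → -s i` with `x > 0`, then `Log Z = log x - s π i / 2 + o(1)`. -/
theorem tendsto_log_sub_log {α : Type*} {l : Filter α} {Z : α → ℂ} {x : α → ℝ}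
    (hs : s = 1 ∨ s = -1) (hx : ∀ᶠ a in l, 0 < x a)
    (hZ : Tendsto (fun a => Z a / x a) l (𝓝 (-(s * Complex.I)))) :
    (∀ᶠ a in l, Z a ∈ Complex.slitPlane) ∧
    Tendsto (fun a => Complex.log (Z a) - (Real.log (x a) : ℝ) + s * (Real.pi / 2) * Complex.I) l
      (𝓝 0) := by
  have him : ((-(s * Complex.I) : ℂ)).im ≠ 0 := by rcases hs with rfl | rfl <;> simp
  have him' : ∀ᶠ a in l, (Z a / x a).im ≠ 0 :=
    ((Complex.continuous_im.tendsto _).comp hZ).eventually_ne him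
  have heq : ∀ᶠ a in l, Z a = x a * (Z a / x a) := by
    filter_upwards [hx] with a ha
    have : (x a : ℂ) ≠ 0 := by exact_mod_cast ha.ne'
    field_simp
  constructor
  · filter_upwards [hx, him', heq] with a ha h1 h2
    right
    rw [h2, Complex.im_ofReal_mul]
    exact mul_ne_zero ha.ne' h1
  · have h1 := ((continuousAt_clog (neg_sign_mul_I_mem_slitPlane hs)).tendsto.comp hZ).add_const
      (s * (Real.pi / 2) * Complex.I : ℂ)
    rw [log_neg_sign_mul_I hs, neg_add_cancel] at h1
    refine h1.congr' ?_
    filter_upwards [hx, him', heq] with a ha h2 h3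
    have h4 : Z a / x a ≠ 0 := fun h0 => h2 (by rw [h0, Complex.zero_im])
    rw [Function.comp_apply]
    nth_rewrite 2 [h3]
    rw [Complex.log_ofReal_mul ha h4]
    ring

theorem tendsto_two_pi_mul_atTop (hμ : 0 < μ) :
    Tendsto (fun t : ℕ => 2 * Real.pi * μ * t) atTop atTop :=
  tendsto_natCast_atTop_atTop.const_mul_atTop (by positivity)

/-- The points `center μ s ω t + w`, for large `t` and `|w| ≤ 2`. -/
theorem tendsto_center_add (hμ : 0 < μ) (ω : ℂ) :
    Tendsto (fun a : ℕ × ℂ => (center μ s ω a.1 + a.2) / (2 * Real.pi * μ * a.1 : ℝ))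
      (atTop ×ˢ 𝓟 (Metric.closedBall 0 2)) (𝓝 (-(s * Complex.I))) := by
  set l : Filter (ℕ × ℂ) := atTop ×ˢ 𝓟 (Metric.closedBall 0 2) with hl
  have hx : Tendsto (fun a : ℕ × ℂ => 2 * Real.pi * μ * a.1) l atTop :=
    (tendsto_two_pi_mul_atTop hμ).comp tendsto_fst
  have hxinv : Tendsto (fun a : ℕ × ℂ => (((2 * Real.pi * μ * a.1)⁻¹ : ℝ) : ℂ)) l (𝓝 0) :=
    (Complex.continuous_ofReal.tendsto' 0 0 Complex.ofReal_zero).comp (tendsto_inv_atTop_zero.comp hx)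
  have hlog : Tendsto (fun a : ℕ × ℂ =>
      ((Real.log (2 * Real.pi * μ * a.1) / (2 * Real.pi * μ * a.1) : ℝ) : ℂ)) l (𝓝 0) :=
    (Complex.continuous_ofReal.tendsto' 0 0 Complex.ofReal_zero).comp
      (Real.isLittleO_log_id_atTop.tendsto_div_nhds_zero.comp hx)
  have hw : Tendsto (fun a : ℕ × ℂ => a.2 * (((2 * Real.pi * μ * a.1)⁻¹ : ℝ) : ℂ)) l (𝓝 0) := by
    refine isBoundedUnder_le_mul_tendsto_zero ⟨2, ?_⟩ hxinv
    rw [eventually_map, hl, eventually_prod_principal_iff]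
    exact Eventually.of_forall fun t w hw => by simpa using hw
  have hmain := ((tendsto_const_nhds (x := (-(s * Complex.I) : ℂ))).add
    ((hlog.const_mul (-μ : ℂ)).add (hxinv.const_mul
      ((μ : ℂ) * (s * (Real.pi / 2) * Complex.I + Complex.log ω))))).add hw
  simp only [mul_zero, add_zero] at hmain
  refine hmain.congr' ?_
  filter_upwards [hx.eventually_gt_atTop 0] with a ha
  have hμ' : (μ : ℂ) ≠ 0 := by exact_mod_cast hμ.ne'
  have hpi : (Real.pi : ℂ) ≠ 0 := by exact_mod_cast Real.pi_ne_zero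
  have ha' : (a.1 : ℂ) ≠ 0 := by
    intro h0
    rw [Nat.cast_eq_zero] at h0
    simp [h0] at ha
  rw [center]
  push_cast
  field_simp
  ring

/-- A small holomorphic function on the disc of radius `2` has exactly one fixed point in the unit
disc: by Cauchy's estimate it is a contraction there. -/
theorem exists_unique_fixedPoint {f : ℂ → ℂ}
    (hf : DifferentiableOn ℂ f (Metric.closedBall 0 2))
    (hb : ∀ w ∈ Metric.closedBall (0 : ℂ) 2, ‖f w‖ ≤ 1 / 4) :
    ∃ w ∈ Metric.closedBall (0 : ℂ) 1, f w = w ∧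
      (∀ w' ∈ Metric.closedBall (0 : ℂ) 1, f w' = w' → w' = w) ∧
      DifferentiableAt ℂ f w ∧ ‖deriv f w‖ ≤ 1 / 4 := by
  have hsub : ∀ w ∈ Metric.closedBall (0 : ℂ) 1, Metric.closedBall w 1 ⊆ Metric.closedBall 0 2 :=
    fun w hw => Metric.closedBall_subset_closedBall' (by
      rw [Metric.mem_closedBall] at hw
      linarith)
  have hdiff : ∀ w ∈ Metric.closedBall (0 : ℂ) 1, DifferentiableAt ℂ f w := fun w hw =>
    hf.differentiableAt (mem_of_superset (Metric.closedBall_mem_nhds w one_pos) (hsub w hw))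
  have hderiv : ∀ w ∈ Metric.closedBall (0 : ℂ) 1, ‖deriv f w‖ ≤ 1 / 4 := by
    intro w hw
    have := Complex.norm_deriv_le_of_forall_mem_sphere_norm_le (f := f) (c := w) (C := 1 / 4) one_pos
      ((hf.mono ((closure_mono Metric.ball_subset_closedBall).trans (by
        rw [Metric.isClosed_closedBall.closure_eq]; exact hsub w hw))).diffContOnCl)
      fun z hz => hb z (hsub w hw (Metric.sphere_subset_closedBall hz))
    simpa using this
  have hlip : ∀ x ∈ Metric.closedBall (0 : ℂ) 1, ∀ y ∈ Metric.closedBall (0 : ℂ) 1,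
      ‖f y - f x‖ ≤ 1 / 4 * ‖y - x‖ := fun x hx y hy =>
    (convex_closedBall (0 : ℂ) 1).norm_image_sub_le_of_norm_deriv_le hdiff hderiv hx hy
  have hmaps : Set.MapsTo f (Metric.closedBall 0 1) (Metric.closedBall 0 1) := fun w hw => by
    have := hb w (Metric.closedBall_subset_closedBall one_le_two hw)
    rw [mem_closedBall_zero_iff]
    linarith
  have hcontr : ContractingWith (1 / 4) (hmaps.restrict f _ _) := by
    refine ⟨by rw [div_lt_one (by norm_num)]; norm_num, LipschitzWith.of_dist_le_mul ?_⟩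
    rintro ⟨x, hx⟩ ⟨y, hy⟩
    simpa [Subtype.dist_eq, dist_eq_norm] using hlip y hy x hx
  obtain ⟨w, hw, hfw, -⟩ := hcontr.exists_fixedPoint' Metric.isClosed_closedBall.isComplete hmaps
    (Metric.mem_closedBall_self zero_le_one) (edist_ne_top _ _)
  refine ⟨w, hw, hfw, fun w' hw' hfw' => ?_, hdiff w hw, hderiv w hw⟩
  have h1 := hlip w hw w' hw'
  rw [hfw, hfw'] at h1
  have h2 : ‖w' - w‖ = 0 := le_antisymm (by linarith) (norm_nonneg _)
  exact sub_eq_zero.1 (norm_eq_zero.1 h2)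

/-- The points `center μ s ω t + w` with `|w| ≤ 2` leave every bounded set as `t → ∞`, stay in a
strip with slope `μ`, and their logarithms are known up to `o(1)`. -/
theorem center_add_mem_strip (hμ : 0 < μ) (hs : s = 1 ∨ s = -1) {C : ℝ}
    (hC : μ * |Real.log ‖ω‖| + 3 ≤ C) :
    (∀ᶠ a in (atTop : Filter ℕ) ×ˢ 𝓟 (Metric.closedBall (0 : ℂ) 2),
      center μ s ω a.1 + a.2 ∈ Complex.slitPlane) ∧
    Tendsto (fun a : ℕ × ℂ => center μ s ω a.1 + a.2) (atTop ×ˢ 𝓟 (Metric.closedBall 0 2))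
      (cobounded ℂ ⊓ 𝓟 (strip μ C)) ∧
    Tendsto (fun a : ℕ × ℂ => Complex.log (center μ s ω a.1 + a.2) -
      (Real.log (2 * Real.pi * μ * a.1) : ℝ) + s * (Real.pi / 2) * Complex.I)
      (atTop ×ˢ 𝓟 (Metric.closedBall 0 2)) (𝓝 0) := by
  set l : Filter (ℕ × ℂ) := atTop ×ˢ 𝓟 (Metric.closedBall 0 2) with hl
  have hx : Tendsto (fun a : ℕ × ℂ => 2 * Real.pi * μ * a.1) l atTop :=
    (tendsto_two_pi_mul_atTop hμ).comp tendsto_fst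
  have hZ := tendsto_center_add (s := s) hμ ω
  obtain ⟨hslit, hlog⟩ := tendsto_log_sub_log hs (hx.eventually_gt_atTop 0) hZ
  refine ⟨hslit, ?_, hlog⟩
  refine tendsto_inf.2 ⟨?_, tendsto_principal.2 ?_⟩
  · rw [← tendsto_norm_atTop_iff_cobounded]
    have h1 : ‖(-(s * Complex.I) : ℂ)‖ = 1 := by rcases hs with rfl | rfl <;> simp
    have h2 := hZ.norm
    rw [h1] at h2
    refine (hx.atTop_mul_pos one_pos h2).congr' ?_
    filter_upwards [hx.eventually_gt_atTop 0] with a ha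
    rw [norm_div, Complex.norm_real, Real.norm_of_nonneg ha.le, mul_div_cancel₀ _ ha.ne']
  · have h1 : Tendsto (fun a : ℕ × ℂ => μ * (Complex.log (center μ s ω a.1 + a.2) -
        (Real.log (2 * Real.pi * μ * a.1) : ℝ) + s * (Real.pi / 2) * Complex.I).re) l (𝓝 0) := by
      have := ((Complex.continuous_re.tendsto 0).comp hlog).const_mul μ
      simpa only [Complex.zero_re, mul_zero, Function.comp_apply] using this
    have h2 := (h1.abs).eventually_lt_const (u := 1) (by simp)
    have h3 : ∀ᶠ a in l, ‖a.2‖ ≤ 2 := by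
      rw [hl, eventually_prod_principal_iff]
      exact Eventually.of_forall fun t w hw => by simpa using hw
    filter_upwards [h2, h3] with a h2 h3
    have h4 : (center μ s ω a.1).re =
        μ * (-Real.log (2 * Real.pi * μ * a.1) + Real.log ‖ω‖) := by
      rw [center, Complex.re_ofReal_mul]
      simp [Complex.log_re]
    have h5 : (Complex.log (center μ s ω a.1 + a.2) -
        (Real.log (2 * Real.pi * μ * a.1) : ℝ) + s * (Real.pi / 2) * Complex.I).re =
        Real.log ‖center μ s ω a.1 + a.2‖ - Real.log (2 * Real.pi * μ * a.1) := by
      rw [Complex.add_re, Complex.sub_re, Complex.log_re, Complex.ofReal_re]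
      simp
    rw [h5] at h2
    have h6 := (Complex.abs_re_le_norm a.2).trans h3
    have h7 : |μ * Real.log ‖ω‖| = μ * |Real.log ‖ω‖| := by rw [abs_mul, abs_of_pos hμ]
    rw [strip, Set.mem_ofPred_eq, Complex.add_re, h4]
    rw [abs_le] at h6
    rw [abs_lt] at h2
    have h8 := neg_abs_le (μ * Real.log ‖ω‖)
    have h9 := le_abs_self (μ * Real.log ‖ω‖)
    rw [abs_le]
    constructor <;> linarith

theorem tendsto_log_div_self : Tendsto (fun ζ : ℂ => Complex.log ζ / ζ) (cobounded ℂ) (𝓝 0) := by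
  have h1 : Tendsto (fun ζ : ℂ => Real.log ‖ζ‖ / ‖ζ‖ + Real.pi / ‖ζ‖) (cobounded ℂ) (𝓝 0) := by
    have h2 := Real.isLittleO_log_id_atTop.tendsto_div_nhds_zero.comp
      (tendsto_norm_cobounded_atTop (E := ℂ))
    have h3 := (tendsto_norm_cobounded_atTop (E := ℂ)).const_div_atTop Real.pi
    simpa using h2.add h3
  refine squeeze_zero_norm' ?_ h1
  filter_upwards [eventually_cobounded_le_norm (E := ℂ) 1] with ζ hζ
  rw [norm_div, ← add_div]
  gcongr
  have h2 := Complex.norm_le_abs_re_add_abs_im (Complex.log ζ)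
  rw [Complex.log_re, Complex.log_im, abs_of_nonneg (Real.log_nonneg hζ)] at h2
  linarith [Complex.abs_arg_le_pi ζ]

theorem IsEdgeForm.eventually_ratio (h : IsEdgeForm D A Φ μ r κ) (C : ℝ) :
    (∀ᶠ ζ in cobounded ℂ ⊓ 𝓟 (strip μ C), Φ ζ ∈ Complex.slitPlane) ∧
    Tendsto (fun ζ => Complex.log (Φ ζ) / r) (cobounded ℂ ⊓ 𝓟 (strip μ C)) (𝓝 0) := by
  refine ⟨(h.tendsto_ratio C).eventually
    (Complex.isOpen_slitPlane.mem_nhds Complex.one_mem_slitPlane), ?_⟩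
  have := ((continuousAt_clog Complex.one_mem_slitPlane).tendsto.comp
    (h.tendsto_ratio C)).div_const (r : ℂ)
  simpa only [Complex.log_one, zero_div, Function.comp_apply] using this

/-- A far zero in the strip that belongs to the branch with index `t` lies close to
`center μ s ω t`, and `t` is large. -/
theorem IsEdgeForm.eventually_near_center (h : IsEdgeForm D A Φ μ r κ) (hs : s = 1 ∨ s = -1)
    (ω : ℂ) (C : ℝ) (t₀ : ℕ) :
    ∀ᶠ ζ in cobounded ℂ ⊓ 𝓟 (strip μ C), ∀ t : ℕ,
      phase Φ μ r ω ζ = -(s * t * (2 * Real.pi * Complex.I)) →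
        t₀ ≤ t ∧ ‖ζ - center μ s ω t‖ ≤ 1 := by
  have hμ := h.slope_pos
  have hμ' : (μ : ℂ) ≠ 0 := by exact_mod_cast hμ.ne'
  set l := cobounded ℂ ⊓ 𝓟 (strip μ C) with hl
  set L : Filter (ℂ × ℕ) := comap Prod.fst l ⊓
    𝓟 {a | phase Φ μ r ω a.1 = -(s * a.2 * (2 * Real.pi * Complex.I))} with hL
  suffices hmain : ∀ᶠ a in L, t₀ ≤ a.2 ∧ ‖a.1 - center μ s ω a.2‖ ≤ 1 by
    rw [hL, eventually_inf_principal, eventually_comap] at hmain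
    filter_upwards [hmain] with ζ hζ t ht
    exact hζ (ζ, t) rfl ht
  have hfst : Tendsto Prod.fst L l := tendsto_comap.mono_left inf_le_left
  have hcob : Tendsto Prod.fst L (cobounded ℂ) := hfst.mono_right inf_le_left
  have heq : ∀ᶠ a in L, phase Φ μ r ω a.1 = -(s * a.2 * (2 * Real.pi * Complex.I)) :=
    mem_inf_of_right (mem_principal_self _)
  have hne : ∀ᶠ a in L, a.1 ≠ 0 := hcob.eventually (eventually_ne_cobounded 0)
  have hG := (h.eventually_ratio C).2.comp hfst
  -- the index is asymptotically proportional to the modulus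
  have hquot : Tendsto (fun a : ℂ × ℕ => -(s * a.2 * (2 * Real.pi * Complex.I)) / a.1) L
      (𝓝 (1 / μ)) := by
    have h1 := tendsto_log_div_self.comp hcob
    have h2 := (tendsto_inv₀_cobounded (α := ℂ)).comp hcob
    have h3 := ((h1.const_add (1 / μ : ℂ)).sub (h2.const_mul (Complex.log ω))).sub (hG.mul h2)
    simp only [add_zero, mul_zero, sub_zero] at h3
    refine h3.congr' ?_
    filter_upwards [heq, hne] with a h4 h5
    rw [← h4, phase]
    simp only [Function.comp_apply]
    field_simp
  have hsnorm : ‖(s : ℂ)‖ = 1 := by rcases hs with rfl | rfl <;> simp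
  have hsI : ((s : ℂ) * Complex.I) * (s * Complex.I) = -1 := by
    rcases hs with rfl | rfl <;> simp [Complex.I_mul_I]
  have hx : Tendsto (fun a : ℂ × ℕ => 2 * Real.pi * μ * a.2) L atTop := by
    have h1 := hquot.norm
    have h2 : 0 < ‖(1 / μ : ℂ)‖ := norm_pos_iff.2 (one_div_ne_zero hμ')
    have h3 := (((tendsto_norm_cobounded_atTop (E := ℂ)).comp hcob).atTop_mul_pos h2 h1).const_mul_atTop
      hμ
    refine h3.congr' ?_
    filter_upwards [hne] with a h5
    rw [norm_div, Function.comp_apply, mul_div_cancel₀ _ (norm_ne_zero_iff.2 h5), norm_neg,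
      norm_mul, norm_mul, hsnorm]
    simp [abs_of_pos Real.pi_pos]
    ring
  have hZ : Tendsto (fun a : ℂ × ℕ => a.1 / (2 * Real.pi * μ * a.2 : ℝ)) L
      (𝓝 (-(s * Complex.I))) := by
    have h1 := (hquot.inv₀ (one_div_ne_zero hμ')).mul_const (-(s * Complex.I) / μ : ℂ)
    have h2 : (1 / (μ : ℂ))⁻¹ * (-(s * Complex.I) / μ) = -(s * Complex.I) := by field_simp
    rw [h2] at h1
    refine h1.congr' ?_
    filter_upwards [hx.eventually_gt_atTop 0, hne] with a ha h5
    have ht : (a.2 : ℂ) ≠ 0 := by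
      intro h0
      rw [Nat.cast_eq_zero] at h0
      simp [h0] at ha
    have hpi : (Real.pi : ℂ) ≠ 0 := by exact_mod_cast Real.pi_ne_zero
    have hs0 : (s : ℂ) ≠ 0 := norm_ne_zero_iff.1 (by rw [hsnorm]; exact one_ne_zero)
    push_cast
    field_simp
  have hlog := (tendsto_log_sub_log hs (hx.eventually_gt_atTop 0) hZ).2
  have hdiff : Tendsto (fun a : ℂ × ℕ => a.1 - center μ s ω a.2) L (𝓝 0) := by
    have h1 := (hG.sub hlog).const_mul (μ : ℂ)
    simp only [sub_zero, mul_zero] at h1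
    refine h1.congr' ?_
    filter_upwards [heq] with a h2
    rw [phase] at h2
    have h3 : a.1 = μ * (a.1 / μ) := by field_simp
    rw [Function.comp_apply, center]
    linear_combination (-μ : ℂ) * h2 - h3
  have hidx : ∀ᶠ a in L, t₀ ≤ a.2 := by
    filter_upwards [hx.eventually_ge_atTop (2 * Real.pi * μ * t₀)] with a ha
    have : 0 < 2 * Real.pi * μ := by positivity
    exact_mod_cast le_of_mul_le_mul_left ha this
  have hnorm := hdiff.norm
  rw [norm_zero] at hnorm
  exact hidx.and (hnorm.eventually_le_const one_pos)

/-- The sequence of simple zeros that belongs to the root `ω` and to a half plane. -/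
theorem IsEdgeForm.exists_zero_sequence (h : IsEdgeForm D A Φ μ r κ) (hω : ω ^ r = κ)
    (hs : s = 1 ∨ s = -1) {C : ℝ} (hC : μ * |Real.log ‖ω‖| + 3 ≤ C) (R : ℝ) :
    ∃ t₀ : ℕ, 1 ≤ t₀ ∧ ∃ z : ℕ → ℂ,
      (∀ t, t₀ ≤ t → D (z t) = 0 ∧ deriv D (z t) ≠ 0 ∧ R ≤ ‖z t‖ ∧ z t ≠ 0 ∧ z t ∈ strip μ C ∧
        phase Φ μ r ω (z t) = -(s * t * (2 * Real.pi * Complex.I))) ∧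
      Tendsto (fun t => z t - center μ s ω t) atTop (𝓝 0) ∧
      ∀ t₁, ∀ᶠ ζ in cobounded ℂ ⊓ 𝓟 (strip μ C), ∀ t : ℕ,
        phase Φ μ r ω ζ = -(s * t * (2 * Real.pi * Complex.I)) → t₁ ≤ t ∧ ζ = z t := by
  have hμ := h.slope_pos
  have hμ' : (μ : ℂ) ≠ 0 := by exact_mod_cast hμ.ne'
  obtain ⟨hslit, htend, hlog⟩ := center_add_mem_strip (ω := ω) hμ hs hC
  set l : Filter (ℕ × ℂ) := atTop ×ˢ 𝓟 (Metric.closedBall 0 2) with hl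
  obtain ⟨hΦslit, hΦlog⟩ := h.eventually_ratio C
  have hcorr : Tendsto (fun a : ℕ × ℂ => correction Φ μ r s ω a.1 a.2) l (𝓝 0) := by
    have := (hlog.sub (hΦlog.comp htend)).const_mul (-μ : ℂ)
    simp only [sub_zero, mul_zero] at this
    exact this
  have hev : ∀ᶠ a in l, center μ s ω a.1 + a.2 ∈ Complex.slitPlane ∧
      Φ (center μ s ω a.1 + a.2) ∈ Complex.slitPlane ∧ R ≤ ‖center μ s ω a.1 + a.2‖ ∧
      center μ s ω a.1 + a.2 ∈ strip μ C ∧ ‖correction Φ μ r s ω a.1 a.2‖ ≤ 1 / 4 := by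
    have h1 := hcorr.norm
    rw [norm_zero] at h1
    have h2 : ∀ᶠ ζ in cobounded ℂ ⊓ 𝓟 (strip μ C), R ≤ ‖ζ‖ ∧ ζ ∈ strip μ C :=
      ((eventually_cobounded_le_norm R).filter_mono inf_le_left).and
        (mem_inf_of_right (mem_principal_self _))
    filter_upwards [hslit, htend.eventually hΦslit, htend.eventually h2,
      h1.eventually_le_const (by norm_num : (0 : ℝ) < 1 / 4)] with a g1 g2 g3 g4
    exact ⟨g1, g2, g3.1, g3.2, g4⟩
  rw [hl, eventually_prod_principal_iff] at hev
  obtain ⟨t₁, ht₁⟩ := eventually_atTop.1 hev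
  have hdiff : ∀ t, t₁ ≤ t → DifferentiableOn ℂ (correction Φ μ r s ω t)
      (Metric.closedBall 0 2) := by
    intro t ht w hw
    obtain ⟨h1, h2, -⟩ := ht₁ t ht w hw
    refine DifferentiableAt.differentiableWithinAt ?_
    have h3 : DifferentiableAt ℂ (fun w => center μ s ω t + w) w := by fun_prop
    have h4 : DifferentiableAt ℂ (fun w => Complex.log (center μ s ω t + w)) w := h3.clog h1
    have h5 : DifferentiableAt ℂ (fun w => Φ (center μ s ω t + w)) w :=
      DifferentiableAt.comp w (h.differentiableAt_ratio _ (Complex.slitPlane_ne_zero h1)) h3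
    have h6 : DifferentiableAt ℂ (fun w => Complex.log (Φ (center μ s ω t + w))) w := h5.clog h2
    unfold correction
    fun_prop
  have hfix : ∀ t, t₁ ≤ t → ∃ w ∈ Metric.closedBall (0 : ℂ) 1, correction Φ μ r s ω t w = w ∧
      (∀ w' ∈ Metric.closedBall (0 : ℂ) 1, correction Φ μ r s ω t w' = w' → w' = w) ∧
      DifferentiableAt ℂ (correction Φ μ r s ω t) w ∧
      ‖deriv (correction Φ μ r s ω t) w‖ ≤ 1 / 4 := fun t ht =>
    exists_unique_fixedPoint (hdiff t ht) fun w hw => (ht₁ t ht w hw).2.2.2.2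
  choose! w hwmem hwfix hwuniq hwdiff hwderiv using hfix
  have hsub : Metric.closedBall (0 : ℂ) 1 ⊆ Metric.closedBall 0 2 :=
    Metric.closedBall_subset_closedBall one_le_two
  refine ⟨max t₁ 1, le_max_right _ _, fun t => center μ s ω t + w t, ?_, ?_, ?_⟩
  · intro t ht
    have htt : t₁ ≤ t := (le_max_left _ _).trans ht
    obtain ⟨h1, h2, h3, h4, -⟩ := ht₁ t htt (w t) (hsub (hwmem t htt))
    have hz0 := Complex.slitPlane_ne_zero h1
    have hΦ0 := Complex.slitPlane_ne_zero h2
    have hph := (phase_eq_iff_isFixedPt (Φ := Φ) (r := r) (ω := ω) hμ.ne' t (w t)).2 (hwfix t htt)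
    have hexp : Complex.exp (r * phase Φ μ r ω (center μ s ω t + w t)) = 1 := by
      rw [Complex.exp_nat_mul, hph, exp_neg_sign_mul hs, one_pow]
    refine ⟨?_, ?_, h3, hz0, h4, hph⟩
    · rw [h.eq_mul_one_sub_exp hω hz0 hΦ0, hexp, sub_self, mul_zero]
    · -- the derivative of the phase does not vanish, as the correction is a contraction
      rw [← deriv_comp_const_add]
      have hev1 : ∀ᶠ x in 𝓝 (w t), D (center μ s ω t + x) =
          A (center μ s ω t + x) * (κ * Φ (center μ s ω t + x)) *
            (1 - Complex.exp (r * (-(s * t * (2 * Real.pi * Complex.I)) +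
              (x - correction Φ μ r s ω t x) / μ))) := by
        have hw2 : Metric.closedBall (0 : ℂ) 2 ∈ 𝓝 (w t) := by
          refine mem_of_superset (Metric.closedBall_mem_nhds (w t) one_pos)
            (Metric.closedBall_subset_closedBall' ?_)
          have := hwmem t htt
          rw [Metric.mem_closedBall] at this
          linarith
        filter_upwards [hw2] with x hx
        obtain ⟨g1, g2, -⟩ := ht₁ t htt x hx
        rw [h.eq_mul_one_sub_exp hω (Complex.slitPlane_ne_zero g1) (Complex.slitPlane_ne_zero g2),
          phase_center_add hμ.ne']
      have hU : DifferentiableAt ℂ (fun x => A (center μ s ω t + x) *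
          (κ * Φ (center μ s ω t + x))) (w t) := by
        have g1 : DifferentiableAt ℂ (fun x => center μ s ω t + x) (w t) := by fun_prop
        have g2 := DifferentiableAt.comp (w t) (h.differentiableAt_factor _ hz0) g1
        have g3 := DifferentiableAt.comp (w t) (h.differentiableAt_ratio _ hz0) g1
        exact g2.mul (g3.const_mul κ)
      have hV := ((((((hasDerivAt_id (w t)).sub (hwdiff t htt).hasDerivAt).div_const
        (μ : ℂ)).const_add (-(s * t * (2 * Real.pi * Complex.I)) : ℂ)).const_mul
          (r : ℂ)).cexp).const_sub 1
      have hprod := (hU.hasDerivAt.mul hV).congr_of_eventuallyEq hev1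
      rw [hprod.deriv]
      have hexp' : Complex.exp (r * (-(s * t * (2 * Real.pi * Complex.I)) +
          (w t - correction Φ μ r s ω t (w t)) / μ)) = 1 := by
        rw [← phase_center_add hμ.ne', hexp]
      simp only [Pi.sub_apply, id_eq, hexp', sub_self, mul_zero, zero_add, one_mul]
      have hne1 : 1 - deriv (correction Φ μ r s ω t) (w t) ≠ 0 := by
        intro h0
        have := hwderiv t htt
        rw [← sub_eq_zero.1 h0, norm_one] at this
        norm_num at this
      have hr : (r : ℂ) ≠ 0 := by exact_mod_cast h.mult_pos.ne'
      exact mul_ne_zero (mul_ne_zero (h.factor_ne_zero _ hz0) (mul_ne_zero h.const_ne_zero hΦ0))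
        (neg_ne_zero.2 (mul_ne_zero hr (div_ne_zero hne1 hμ')))
  · have hpair : Tendsto (fun t => (t, w t)) atTop l := by
      refine tendsto_id.prodMk (tendsto_principal.2 ?_)
      filter_upwards [eventually_ge_atTop t₁] with t ht using hsub (hwmem t ht)
    refine (hcorr.comp hpair).congr' ?_
    filter_upwards [eventually_ge_atTop t₁] with t ht
    rw [add_sub_cancel_left]
    exact hwfix t ht
  · intro t₂
    filter_upwards [h.eventually_near_center hs ω C (max t₁ t₂)] with ζ hζ t ht
    obtain ⟨h1, h2⟩ := hζ t ht
    have htt : t₁ ≤ t := (le_max_left _ _).trans h1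
    refine ⟨(le_max_right _ _).trans h1, ?_⟩
    have h3 : center μ s ω t + (ζ - center μ s ω t) = ζ := add_sub_cancel _ _
    rw [← h3, phase_eq_iff_isFixedPt hμ.ne'] at ht
    rw [← hwuniq t htt _ (mem_closedBall_zero_iff.2 h2) ht, h3]

end EdgeZeros

/-! ### Counting zeros along finitely many sequences -/

section Counting

open Filter Topology Bornology

theorem finite_zeros_of_isBounded {f : ℂ → ℂ} (hf : Differentiable ℂ f) (hf0 : f ≠ 0) {s : Set ℂ}
    (hs : IsBounded s) (hz : ∀ x ∈ s, f x = 0) : s.Finite := by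
  by_contra hinf
  obtain ⟨x, -, hx⟩ := Set.Infinite.exists_accPt_of_subset_isCompact hinf
    hs.isCompact_closure subset_closure
  refine hf0 (funext fun y => ?_)
  refine AnalyticOnNhd.eqOn_zero_of_preconnected_of_frequently_eq_zero
    (fun z _ => hf.analyticAt z) isPreconnected_univ (Set.mem_univ x) ?_ (Set.mem_univ y)
  exact (accPt_iff_frequently_nhdsNE.1 hx).mono hz

/-- If the far zeros of an entire function are simple and listed without repetition by finitely many
sequences, then all its zeros, counted with multiplicity, are listed by these sequences together
with a finite multiset. -/
theorem exists_multiset_count {ι : Type*} {f : ℂ → ℂ} (hf : Differentiable ℂ f) (S : Finset ι)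
    (t₀ : ι → ℕ) (z : ι → ℕ → ℂ)
    (hsimple : ∀ i ∈ S, ∀ t, t₀ i ≤ t → f (z i t) = 0 ∧ deriv f (z i t) ≠ 0)
    (hinj : ∀ i ∈ S, ∀ i' ∈ S, ∀ t t', t₀ i ≤ t → t₀ i' ≤ t' → z i t = z i' t' → i = i' ∧ t = t')
    {R : ℝ} (hR : ∀ x, R ≤ ‖x‖ → f x = 0 → ∃ i ∈ S, ∃ t, t₀ i ≤ t ∧ x = z i t) :
    (∃ K₀ : Multiset ℂ, ∀ x, analyticOrderAt f x =
      (K₀.count x : ℕ∞) + ∑ i ∈ S, seqCount (t₀ i) (z i) x) ∧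
    ∀ x, R ≤ ‖x‖ → f x = 0 → analyticOrderAt f x = 1 := by
  classical
  have hone : ∀ i ∈ S, ∀ t, t₀ i ≤ t → analyticOrderAt f (z i t) = 1 := fun i hi t ht =>
    (hf.analyticAt _).analyticOrderAt_eq_one_of_zero_deriv_ne_zero (hsimple i hi t ht).1
      (hsimple i hi t ht).2
  have hfar : ∀ x, R ≤ ‖x‖ → f x = 0 → analyticOrderAt f x = 1 := by
    intro x hx hfx
    obtain ⟨i, hi, t, ht, rfl⟩ := hR x hx hfx
    exact hone i hi t ht
  refine ⟨?_, hfar⟩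
  have hf0 : f ≠ 0 := by
    rintro rfl
    have h1 := hfar (|R| : ℝ) (by simpa using le_abs_self R) rfl
    have h2 : analyticOrderAt (0 : ℂ → ℂ) ((|R| : ℝ) : ℂ) = ⊤ := analyticOrderAt_eq_top.2 (by simp)
    rw [h2] at h1
    exact absurd h1 (by decide)
  have hfin : ∀ x, analyticOrderAt f x ≠ ⊤ := fun x h =>
    hf0 ((AnalyticOnNhd.analyticOrderAt_eq_top_iff_eq_zero x fun y => hf.analyticAt y).1 h)
  set Z : Set ℂ := {x | f x = 0 ∧ ∀ i ∈ S, ∀ t, t₀ i ≤ t → x ≠ z i t} with hZ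
  have hZfin : Z.Finite := by
    refine finite_zeros_of_isBounded hf hf0 ((Metric.isBounded_ball (x := (0 : ℂ)) (r := R)).subset ?_)
      fun x hx => hx.1
    intro x hx
    rw [mem_ball_zero_iff]
    by_contra! hge
    obtain ⟨i, hi, t, ht, hxz⟩ := hR x hge hx.1
    exact hx.2 i hi t ht hxz
  refine ⟨∑ x ∈ hZfin.toFinset, Multiset.replicate (analyticOrderNatAt f x) x, fun x => ?_⟩
  have hcount : (∑ y ∈ hZfin.toFinset, Multiset.replicate (analyticOrderNatAt f y) y).count x =
      if x ∈ Z then analyticOrderNatAt f x else 0 := by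
    simp only [Multiset.count_sum', Multiset.count_replicate]
    rw [Finset.sum_ite_eq']
    simp
  rw [hcount]
  by_cases hx : ∃ i ∈ S, ∃ t, t₀ i ≤ t ∧ x = z i t
  · obtain ⟨i, hi, t, ht, rfl⟩ := hx
    have h1 : z i t ∉ Z := fun h => h.2 i hi t ht rfl
    have h2 : ∀ i' ∈ S, i' ≠ i → seqCount (t₀ i') (z i') (z i t) = 0 := by
      intro i' hi' hne
      rw [seqCount, Set.encard_eq_zero, Set.eq_empty_iff_forall_notMem]
      rintro t' ⟨ht', heq⟩
      exact hne (hinj i' hi' i hi t' t ht' ht heq).1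
    have h3 : seqCount (t₀ i) (z i) (z i t) = 1 := by
      have : {t' : ℕ | t₀ i ≤ t' ∧ z i t' = z i t} = {t} := by
        ext t'
        simp only [Set.mem_ofPred_eq, Set.mem_singleton_iff]
        constructor
        · rintro ⟨ht', heq⟩
          exact (hinj i hi i hi t' t ht' ht heq).2
        · rintro rfl
          exact ⟨ht, rfl⟩
      rw [seqCount, this, Set.encard_singleton]
    rw [if_neg h1, Finset.sum_eq_single_of_mem i hi h2, h3, hone i hi t ht]
    simp
  · push Not at hx
    have h2 : ∀ i ∈ S, seqCount (t₀ i) (z i) x = 0 := by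
      intro i hi
      rw [seqCount, Set.encard_eq_zero, Set.eq_empty_iff_forall_notMem]
      rintro t ⟨ht, heq⟩
      exact hx i hi t ht heq.symm
    rw [Finset.sum_eq_zero h2, add_zero]
    by_cases hfx : f x = 0
    · rw [if_pos ⟨hfx, hx⟩, Nat.cast_analyticOrderNatAt (hfin x)]
    · rw [if_neg fun h => hfx h.1, (hf.analyticAt x).analyticOrderAt_eq_zero.2 hfx, Nat.cast_zero]

end Counting

/-! ### All zeros of an exponential polynomial -/

section Chain

open Filter Topology Bornology

/-- The sign that distinguishes the two half planes. -/
def boolSign (c : Bool) : ℝ := bif c then 1 else -1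

theorem boolSign_eq (c : Bool) : boolSign c = 1 ∨ boolSign c = -1 := by
  cases c <;> simp [boolSign]

theorem boolSign_injective : Function.Injective boolSign := by
  intro c c' h
  cases c <;> cases c' <;> simp_all [boolSign] <;> norm_num at h

theorem exists_boolSign {s : ℝ} (hs : s = 1 ∨ s = -1) : ∃ c, s = boolSign c := by
  rcases hs with rfl | rfl
  · exact ⟨true, rfl⟩
  · exact ⟨false, rfl⟩

theorem strip_mono {μ C C' : ℝ} (h : C ≤ C') : strip μ C ⊆ strip μ C' := fun _ hζ => le_trans hζ h

/-- Strips with different slopes are disjoint far from the origin. -/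
theorem eventually_strip_disjoint {μ μ' : ℝ} (h : μ ≠ μ') (C : ℝ) :
    ∀ᶠ ζ in cobounded ℂ, ζ ∈ strip μ C → ζ ∉ strip μ' C := by
  have h1 : Tendsto (fun ζ : ℂ => |μ - μ'| * Real.log ‖ζ‖) (cobounded ℂ) atTop :=
    (Real.tendsto_log_atTop.comp tendsto_norm_cobounded_atTop).const_mul_atTop
      (abs_pos.2 (sub_ne_zero.2 h))
  filter_upwards [h1.eventually_gt_atTop (2 * C), eventually_cobounded_le_norm 1] with ζ h2 h3 h4 h5
  rw [← abs_of_nonneg (Real.log_nonneg h3), ← abs_mul] at h2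
  simp only [strip, Set.mem_ofPred_eq] at h4 h5
  have h6 := abs_sub (ζ.re + μ * Real.log ‖ζ‖) (ζ.re + μ' * Real.log ‖ζ‖)
  rw [show ζ.re + μ * Real.log ‖ζ‖ - (ζ.re + μ' * Real.log ‖ζ‖) = (μ - μ') * Real.log ‖ζ‖ by ring]
    at h6
  linarith

variable {B : Finset ℝ} {P : ℝ → ℂ[X]} {M : ℕ} {v : ℕ → ℝ} {ω : ℕ → ℕ → ℂ}

/-- The far zeros of an exponential polynomial whose distribution diagram has only increasing edges
without interior points: they are simple and form, for each edge, each root `ω` and each half plane,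
one sequence close to `center`. -/
theorem IsEdgeChain.exists_zero_sequences (h : IsEdgeChain B P M v) (hP : ∀ b ∈ B, P b ≠ 0)
    (hω : ∀ n, 1 ≤ n → n ≤ M → ∀ x : ℂ,
      x ^ ((P (v n)).natDegree - (P (v (n - 1))).natDegree) =
        -(P (v (n - 1))).leadingCoeff / (P (v n)).leadingCoeff ↔
      ∃ j < (P (v n)).natDegree - (P (v (n - 1))).natDegree, x = ω n j)
    (hωinj : ∀ n, 1 ≤ n → n ≤ M → ∀ j < (P (v n)).natDegree - (P (v (n - 1))).natDegree,
      ∀ j' < (P (v n)).natDegree - (P (v (n - 1))).natDegree, ω n j = ω n j' → j = j') :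
    ∃ (t₀ : ℕ → ℕ → ℕ) (z : ℕ → ℕ → Bool → ℕ → ℂ) (R : ℝ),
      (∀ n, 1 ≤ n → n ≤ M → ∀ j < (P (v n)).natDegree - (P (v (n - 1))).natDegree, ∀ c,
        1 ≤ t₀ n j ∧
        (∀ t, t₀ n j ≤ t → expPoly B P (z n j c t) = 0 ∧ deriv (expPoly B P) (z n j c t) ≠ 0) ∧
        Tendsto (fun t => z n j c t -
          center (edgeSlope P (v (n - 1)) (v n)) (boolSign c) (ω n j) t) atTop (𝓝 0) ∧
        ∀ n', 1 ≤ n' → n' ≤ M → ∀ j' < (P (v n')).natDegree - (P (v (n' - 1))).natDegree,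
          ∀ c' t t', t₀ n j ≤ t → t₀ n' j' ≤ t' → z n j c t = z n' j' c' t' →
            n = n' ∧ j = j' ∧ c = c' ∧ t = t') ∧
      ∀ ζ, R ≤ ‖ζ‖ → expPoly B P ζ = 0 →
        ∃ n, 1 ≤ n ∧ n ≤ M ∧ ∃ j < (P (v n)).natDegree - (P (v (n - 1))).natDegree,
          ∃ c t, t₀ n j ≤ t ∧ ζ = z n j c t := by
  set μ : ℕ → ℝ := fun n => edgeSlope P (v (n - 1)) (v n) with hμ
  set r : ℕ → ℕ := fun n => (P (v n)).natDegree - (P (v (n - 1))).natDegree with hr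
  set Φ : ℕ → ℂ → ℂ := fun n => edgeRatio B P (v (n - 1)) (v n) with hΦ
  have hform := fun n (h1 : 1 ≤ n) (hn : n ≤ M) => (h.isEdge n h1 hn).isEdgeForm hP
  have hω0 : ∀ n, 1 ≤ n → n ≤ M → ∀ j < r n, ω n j ≠ 0 := by
    intro n h1 hn j hj h0
    have h2 := (hω n h1 hn (ω n j)).2 ⟨j, hj, rfl⟩
    rw [h0, zero_pow (hform n h1 hn).mult_pos.ne'] at h2
    exact (hform n h1 hn).const_ne_zero h2.symm
  -- a width of the strips that works for all edges and all roots
  obtain ⟨C₀, R₀, hcover⟩ := h.exists_strip hP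
  have hexC : ∀ᶠ C in atTop, C₀ ≤ C ∧ ∀ n ∈ Finset.Icc 1 M, ∀ j ∈ Finset.range (r n),
      μ n * |Real.log ‖ω n j‖| + 3 ≤ C := by
    refine (eventually_ge_atTop C₀).and ?_
    rw [eventually_all_finset]
    intro n _
    rw [eventually_all_finset]
    exact fun j _ => eventually_ge_atTop _
  obtain ⟨C, hC₀, hC⟩ := hexC.exists
  have hexR : ∀ᶠ ζ in cobounded ℂ, ∀ n ∈ Finset.Icc 1 M, ∀ n' ∈ Finset.Icc 1 M, n ≠ n' →
      ζ ∈ strip (μ n) C → ζ ∉ strip (μ n') C := by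
    rw [eventually_all_finset]
    intro n hn
    rw [eventually_all_finset]
    intro n' hn'
    by_cases hne : n = n'
    · exact Eventually.of_forall fun _ h0 => absurd hne h0
    · rw [Finset.mem_Icc] at hn hn'
      have hμne : μ n ≠ μ n' := by
        rcases lt_or_gt_of_ne hne with hlt | hlt
        · exact (h.slope_strictAnti hn.1 hlt hn'.2).ne'
        · exact (h.slope_strictAnti hn'.1 hlt hn.2).ne
      filter_upwards [eventually_strip_disjoint hμne C] with ζ hζ _ using hζ
  obtain ⟨R₁, -, hR₁⟩ := (hasBasis_cobounded_norm (E := ℂ)).eventually_iff.1 hexR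
  have hseq : ∀ n j (c : Bool), (1 ≤ n ∧ n ≤ M) ∧ j < r n → _ := fun n j c hnj =>
    (hform n hnj.1.1 hnj.1.2).exists_zero_sequence
      ((hω n hnj.1.1 hnj.1.2 (ω n j)).2 ⟨j, hnj.2, rfl⟩) (boolSign_eq c)
      (hC n (Finset.mem_Icc.2 hnj.1) j (Finset.mem_range.2 hnj.2)) R₁
  choose! t₁ ht₁ z hz hztend hzcompl using hseq
  set t₀ : ℕ → ℕ → ℕ := fun n j => max (t₁ n j true) (t₁ n j false) with ht₀
  have ht₁₀ : ∀ n j c, t₁ n j c ≤ t₀ n j := by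
    intro n j c
    cases c
    · exact le_max_right _ _
    · exact le_max_left _ _
  have hfar : ∀ᶠ ζ in cobounded ℂ, R₀ ≤ ‖ζ‖ ∧ ζ ≠ 0 ∧ ∀ n ∈ Finset.Icc 1 M, ζ ∈ strip (μ n) C →
      Φ n ζ ≠ 0 ∧ ∀ j ∈ Finset.range (r n), ∀ c : Bool, ∀ t : ℕ,
        phase (Φ n) (μ n) (r n) (ω n j) ζ = -(boolSign c * t * (2 * Real.pi * Complex.I)) →
          t₀ n j ≤ t ∧ ζ = z n j c t := by
    refine (eventually_cobounded_le_norm R₀).and ((eventually_ne_cobounded 0).and ?_)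
    rw [eventually_all_finset]
    intro n hn
    have hn' := Finset.mem_Icc.1 hn
    rw [← eventually_inf_principal]
    refine ((hform n hn'.1 hn'.2).eventually_ratio C).1.mono (fun ζ => Complex.slitPlane_ne_zero)
      |>.and ?_
    rw [eventually_all_finset]
    intro j hj
    rw [eventually_all]
    exact fun c => hzcompl n j c ⟨hn', Finset.mem_range.1 hj⟩ _
  obtain ⟨R, -, hR⟩ := (hasBasis_cobounded_norm (E := ℂ)).eventually_iff.1 hfar
  refine ⟨t₀, z, R, ?_, ?_⟩
  · intro n h1 hn j hj c
    have hnj : (1 ≤ n ∧ n ≤ M) ∧ j < r n := ⟨⟨h1, hn⟩, hj⟩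
    refine ⟨(ht₁ n j c hnj).trans (ht₁₀ n j c), fun t ht => ?_, hztend n j c hnj, ?_⟩
    · obtain ⟨g1, g2, -⟩ := hz n j c hnj t ((ht₁₀ n j c).trans ht)
      exact ⟨g1, g2⟩
    · intro n' h1' hn' j' hj' c' t t' ht ht' heq
      have hnj' : (1 ≤ n' ∧ n' ≤ M) ∧ j' < r n' := ⟨⟨h1', hn'⟩, hj'⟩
      obtain ⟨-, -, g1, g2, g3, g4⟩ := hz n j c hnj t ((ht₁₀ n j c).trans ht)
      obtain ⟨-, -, -, -, g3', g4'⟩ := hz n' j' c' hnj' t' ((ht₁₀ n' j' c').trans ht')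
      rw [← heq] at g3' g4'
      have hnn : n = n' := by
        by_contra hne
        exact hR₁ g1 n (Finset.mem_Icc.2 hnj.1) n' (Finset.mem_Icc.2 hnj'.1) hne g3 g3'
      subst hnn
      obtain ⟨g5, g6, g7⟩ := phase_eq_unique g2 (hω0 n h1 hn j hj) (hω0 n h1 hn j' hj')
        (boolSign_eq c) (boolSign_eq c')
        ((ht₁ n j c hnj).trans ((ht₁₀ n j c).trans ht)) g4 g4'
      exact ⟨rfl, hωinj n h1 hn j hj j' hj' g5, boolSign_injective g6, g7⟩
  · intro ζ hζR hζ0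
    obtain ⟨g1, g2, g3⟩ := hR hζR
    obtain ⟨n, h1, hn, hstrip⟩ := hcover ζ g1 hζ0
    obtain ⟨g4, g5⟩ := g3 n (Finset.mem_Icc.2 ⟨h1, hn⟩) (strip_mono hC₀ hstrip)
    obtain ⟨x, hx, s, hs, t, ht⟩ := (hform n h1 hn).exists_phase_eq g2 g4 hζ0
    obtain ⟨j, hj, rfl⟩ := (hω n h1 hn x).1 hx
    obtain ⟨c, rfl⟩ := exists_boolSign hs
    obtain ⟨g6, g7⟩ := g5 j (Finset.mem_range.2 hj) c t ht
    exact ⟨n, h1, hn, j, hj, c, t, g6, g7⟩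

end Chain

/-! ### The polynomials `q_n` and the resonances -/

section Resonances

open Filter Topology

theorem exists_map_range_eq (m : Multiset ℂ) :
    ∃ g : ℕ → ℂ, m = (Multiset.range m.card).map g := by
  induction m using Quotient.inductionOn with
  | h l =>
    refine ⟨fun i => l.getD i 0, ?_⟩
    simp only [Multiset.quot_mk_to_coe, Multiset.coe_card]
    rw [← Multiset.coe_range, Multiset.map_coe, Multiset.coe_eq_coe]
    refine List.Perm.of_eq (List.ext_getElem (by simp) fun i h1 h2 => ?_)
    simp [h1]

/-- The roots of a binomial, listed without repetition. -/
theorem exists_roots_binomial {r : ℕ} (hr : 0 < r) {c d : ℂ} (hc : c ≠ 0) (hd : d ≠ 0) :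
    ∃ g : ℕ → ℂ, (C c + C d * X ^ r : ℂ[X]).roots = (Multiset.range r).map g ∧
      (∀ x : ℂ, x ^ r = -c / d ↔ ∃ j < r, x = g j) ∧
      ∀ j < r, ∀ j' < r, g j = g j' → j = j' := by
  have hcd : -c / d ≠ 0 := div_ne_zero (neg_ne_zero.2 hc) hd
  have hfact : (C c + C d * X ^ r : ℂ[X]) = C d * (X ^ r - C (-c / d)) := by
    rw [mul_sub, ← C_mul, mul_div_cancel₀ _ hd, C_neg]
    ring
  have hroots : (C c + C d * X ^ r : ℂ[X]).roots = (X ^ r - C (-c / d)).roots := by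
    rw [hfact, roots_C_mul _ hd]
  have hcard : (X ^ r - C (-c / d) : ℂ[X]).roots.card = r := by
    rw [IsAlgClosed.card_roots_eq_natDegree, natDegree_X_pow_sub_C]
  obtain ⟨g, hg⟩ := exists_map_range_eq (X ^ r - C (-c / d) : ℂ[X]).roots
  rw [hcard] at hg
  refine ⟨g, hroots.trans hg, fun x => ?_, ?_⟩
  · have h1 : x ∈ (X ^ r - C (-c / d) : ℂ[X]).roots ↔ x ^ r = -c / d := mem_nthRoots hr
    rw [← h1, hg]
    simp [eq_comm]
  · have hnodup : (X ^ r - C (-c / d) : ℂ[X]).roots.Nodup :=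
      nodup_roots (separable_X_pow_sub_C _ (by exact_mod_cast hr.ne') hcd)
    rw [hg] at hnodup
    intro j hj j' hj' h
    exact Multiset.inj_on_of_nodup_map hnodup j (Multiset.mem_range.2 hj) j'
      (Multiset.mem_range.2 hj') h

variable {N : ℕ} {a : Fin N → ℂ} {Y : Fin N → E3}

theorem DistributionDiagram.segPoly_eq (L : DistributionDiagram a Y) {n : ℕ}
    (h : IsEdge (freqs a Y) (freqPoly a Y) (L.vertex (n - 1)) (L.vertex n)) :
    L.segPoly n = C (freqPoly a Y (L.vertex (n - 1))).leadingCoeff +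
      C (freqPoly a Y (L.vertex n)).leadingCoeff * X ^ L.mult n := by
  have hseg : L.segFreqs n = {L.vertex (n - 1), L.vertex n} := by
    ext b
    rw [DistributionDiagram.segFreqs, Finset.mem_filter, Finset.mem_insert, Finset.mem_singleton]
    constructor
    · rintro ⟨hb, -, -, hline⟩
      by_contra! hne
      exact (h.below b hb hne.1 hne.2).ne hline
    · rintro (rfl | rfl)
      · exact ⟨h.left_mem, le_rfl, h.lt.le, by simp⟩
      · refine ⟨h.right_mem, h.lt.le, le_rfl, ?_⟩
        have h1 : L.slope n = edgeSlope (freqPoly a Y) (L.vertex (n - 1)) (L.vertex n) := rfl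
        rw [h1, edgeSlope_mul h.lt]
        ring
  rw [DistributionDiagram.segPoly, hseg, Finset.sum_pair h.lt.ne, Nat.sub_self, pow_zero, mul_one,
    DistributionDiagram.mult]

/-- A sequence of zeros close to `center`, multiplied by `i`, has the asymptotics of the theorem. -/
theorem hasLogAsymptotics_of_tendsto_center {μ s : ℝ} {ω : ℂ} {z : ℕ → ℂ} (hμ : 0 < μ)
    (hz : Tendsto (fun t => z t - center μ s ω t) atTop (𝓝 0)) :
    HasLogAsymptotics s μ ω fun t => Complex.I * z t := by
  have hμ' : (μ : ℂ) ≠ 0 := by exact_mod_cast hμ.ne'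
  have h1 := hz.const_mul (Complex.I / μ)
  rw [mul_zero] at h1
  refine h1.congr' ?_
  filter_upwards [eventually_ge_atTop 1] with t ht
  have ht0 : (0 : ℝ) < t := by exact_mod_cast ht
  have hlog : ((Real.log (2 * Real.pi * μ * t) : ℝ) : ℂ) =
      Complex.log (2 * (Real.pi : ℂ) * (μ : ℂ)) + Complex.log (t : ℂ) := by
    rw [Real.log_mul (by positivity) ht0.ne', Complex.ofReal_add, Complex.ofReal_log (by positivity),
      Complex.ofReal_log ht0.le]
    push_cast
    rfl
  rw [center, hlog]
  field_simp
  linear_combination ((s : ℂ) * μ * (Real.pi * (4 * t - 1))) * Complex.I_sq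

theorem charDet_eq_expPoly (hY : Function.Injective Y) (k : ℂ) :
    charDet a Y k = ((-4 * (Real.pi : ℂ)) ^ N)⁻¹ *
      expPoly (freqs a Y) (freqPoly a Y) (-Complex.I * k) := by
  have h1 := modDet_eq_sum a Y hY (-Complex.I * k)
  have hpi : (-4 * (Real.pi : ℂ)) ^ N ≠ 0 :=
    pow_ne_zero _ (mul_ne_zero (by norm_num) (by exact_mod_cast Real.pi_ne_zero))
  have h2 : Complex.I * (-Complex.I * k) = k := by linear_combination (-k) * Complex.I_sq
  rw [modDet, h2] at h1
  rw [expPoly, ← h1, inv_mul_cancel_left₀ hpi]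

/-- The decomposition of the multiset of resonances for a distribution diagram with increasing
edges without interior points. -/
theorem DistributionDiagram.exists_decomposition (hY : Function.Injective Y)
    (L : DistributionDiagram a Y)
    (h : IsEdgeChain (freqs a Y) (freqPoly a Y) L.M L.vertex) :
    (∃ (ω : ℕ → ℕ → ℂ) (t₀ : ℕ → ℕ → ℕ) (kplus kminus : ℕ → ℕ → ℕ → ℂ) (K₀ : Multiset ℂ),
      (∀ n ∈ Finset.Icc 1 L.M, (L.segPoly n).roots = (Multiset.range (L.mult n)).map (ω n)) ∧
      (∀ n ∈ Finset.Icc 1 L.M, ∀ j ∈ Finset.range (L.mult n),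
        ω n j ≠ 0 ∧ 1 ≤ t₀ n j ∧
        HasLogAsymptotics 1 (L.slope n) (ω n j) (kplus n j) ∧
        HasLogAsymptotics (-1) (L.slope n) (ω n j) (kminus n j)) ∧
      ∀ z : ℂ, resonanceMult a Y z = (K₀.count z : ℕ∞) +
        ∑ n ∈ Finset.Icc 1 L.M, ∑ j ∈ Finset.range (L.mult n),
          (seqCount (t₀ n j) (kplus n j) z + seqCount (t₀ n j) (kminus n j) z)) ∧
    ∃ R : ℝ, 0 ≤ R ∧ ∀ k : ℂ, IsResonance a Y k → R ≤ ‖k‖ → resonanceMult a Y k = 1 := by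
  have hP : ∀ b ∈ freqs a Y, freqPoly a Y b ≠ 0 := fun b hb => (mem_freqs a Y b).1 hb
  have hroots : ∀ n, 1 ≤ n ∧ n ≤ L.M → ∃ g : ℕ → ℂ,
      (L.segPoly n).roots = (Multiset.range (L.mult n)).map g ∧
      (∀ x : ℂ, x ^ L.mult n = -(freqPoly a Y (L.vertex (n - 1))).leadingCoeff /
        (freqPoly a Y (L.vertex n)).leadingCoeff ↔ ∃ j < L.mult n, x = g j) ∧
      ∀ j < L.mult n, ∀ j' < L.mult n, g j = g j' → j = j' := by
    intro n hn
    have he := h.isEdge n hn.1 hn.2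
    rw [L.segPoly_eq he]
    exact exists_roots_binomial (Nat.sub_pos_of_lt he.natDegree_lt)
      (leadingCoeff_ne_zero.2 (hP _ he.left_mem)) (leadingCoeff_ne_zero.2 (hP _ he.right_mem))
  choose! ω hω1 hω2 hω3 using hroots
  obtain ⟨t₀, z, R, hseq, hfar⟩ := h.exists_zero_sequences hP
    (fun n h1 hn => hω2 n ⟨h1, hn⟩) (fun n h1 hn => hω3 n ⟨h1, hn⟩)
  have hD := differentiable_expPoly (freqs a Y) (freqPoly a Y)
  have hchar : charDet a Y = fun k => ((-4 * (Real.pi : ℂ)) ^ N)⁻¹ *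
      expPoly (freqs a Y) (freqPoly a Y) (-Complex.I * k) := funext (charDet_eq_expPoly hY)
  have hc0 : ((-4 * (Real.pi : ℂ)) ^ N)⁻¹ ≠ 0 := inv_ne_zero
    (pow_ne_zero _ (mul_ne_zero (by norm_num) (by exact_mod_cast Real.pi_ne_zero)))
  have hdiff : Differentiable ℂ (charDet a Y) := by
    rw [hchar]
    exact (hD.comp (differentiable_id.const_mul (-Complex.I))).const_mul _
  have hII : ∀ ζ : ℂ, -Complex.I * (Complex.I * ζ) = ζ := fun ζ => by
    linear_combination (-ζ) * Complex.I_sq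
  have hII' : ∀ ζ : ℂ, Complex.I * (-Complex.I * ζ) = ζ := fun ζ => by
    linear_combination (-ζ) * Complex.I_sq
  have hzero : ∀ k, charDet a Y k = 0 ↔
      expPoly (freqs a Y) (freqPoly a Y) (-Complex.I * k) = 0 := fun k => by
    rw [charDet_eq_expPoly hY, mul_eq_zero, or_iff_right hc0]
  have hderiv : ∀ ζ, deriv (expPoly (freqs a Y) (freqPoly a Y)) ζ ≠ 0 →
      deriv (charDet a Y) (Complex.I * ζ) ≠ 0 := by
    intro ζ hζ
    have h1 : HasDerivAt (fun k => -Complex.I * k) (-Complex.I) (Complex.I * ζ) := by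
      simpa using (hasDerivAt_id (Complex.I * ζ)).const_mul (-Complex.I)
    have h2 : HasDerivAt (expPoly (freqs a Y) (freqPoly a Y))
        (deriv (expPoly (freqs a Y) (freqPoly a Y)) ζ) (-Complex.I * (Complex.I * ζ)) := by
      rw [hII]
      exact (hD ζ).hasDerivAt
    have h3 := (h2.comp (Complex.I * ζ) h1).const_mul ((-4 * (Real.pi : ℂ)) ^ N)⁻¹
    rw [hchar]
    exact h3.deriv.trans_ne (mul_ne_zero hc0 (mul_ne_zero hζ (neg_ne_zero.2 Complex.I_ne_zero)))
  set S := ((Finset.Icc 1 L.M).sigma fun n => Finset.range (L.mult n)) ×ˢ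
    (Finset.univ : Finset Bool) with hS
  have hmemS : ∀ i : (Σ _ : ℕ, ℕ) × Bool, i ∈ S ↔
      (1 ≤ i.1.1 ∧ i.1.1 ≤ L.M) ∧ i.1.2 < L.mult i.1.1 := by
    intro i
    simp [hS]
  obtain ⟨⟨K₀, hK₀⟩, hone⟩ := exists_multiset_count hdiff S (fun i => t₀ i.1.1 i.1.2)
    (fun i t => Complex.I * z i.1.1 i.1.2 i.2 t) (R := R) (by
      intro i hi t ht
      obtain ⟨⟨h1, hn⟩, hj⟩ := (hmemS i).1 hi
      obtain ⟨g1, g2⟩ := (hseq i.1.1 h1 hn i.1.2 hj i.2).2.1 t ht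
      exact ⟨by rw [hzero, hII, g1], hderiv _ g2⟩) (by
      rintro ⟨⟨n, j⟩, c⟩ hi ⟨⟨n', j'⟩, c'⟩ hi' t t' ht ht' heq
      obtain ⟨⟨h1, hn⟩, hj⟩ := (hmemS _).1 hi
      obtain ⟨⟨h1', hn'⟩, hj'⟩ := (hmemS _).1 hi'
      obtain ⟨rfl, rfl, rfl, rfl⟩ := (hseq n h1 hn j hj c).2.2.2 n' h1' hn' j' hj' c' t t' ht ht'
        (mul_left_cancel₀ Complex.I_ne_zero heq)
      exact ⟨rfl, rfl⟩) (by
      intro k hk hk0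
      obtain ⟨n, h1, hn, j, hj, c, t, ht, heq⟩ := hfar (-Complex.I * k) (by simpa using hk)
        ((hzero k).1 hk0)
      exact ⟨⟨⟨n, j⟩, c⟩, (hmemS _).2 ⟨⟨h1, hn⟩, hj⟩, t, ht, by rw [← heq, hII']⟩)
  refine ⟨⟨ω, t₀, fun n j t => Complex.I * z n j true t, fun n j t => Complex.I * z n j false t, K₀,
    fun n hn => hω1 n (Finset.mem_Icc.1 hn), fun n hn j hj => ?_, fun k => ?_⟩,
    max R 0, le_max_right _ _, fun k hk hRk => hone k ((le_max_left _ _).trans hRk) hk⟩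
  · obtain ⟨h1, hn⟩ := Finset.mem_Icc.1 hn
    have hj := Finset.mem_range.1 hj
    have he := h.isEdge n h1 hn
    refine ⟨fun h0 => ?_, (hseq n h1 hn j hj true).1,
      hasLogAsymptotics_of_tendsto_center he.slope_pos (hseq n h1 hn j hj true).2.2.1,
      hasLogAsymptotics_of_tendsto_center he.slope_pos (hseq n h1 hn j hj false).2.2.1⟩
    have h2 := (hω2 n ⟨h1, hn⟩ (ω n j)).2 ⟨j, hj, rfl⟩
    rw [h0, zero_pow (by omega)] at h2
    exact div_ne_zero (neg_ne_zero.2 (leadingCoeff_ne_zero.2 (hP _ he.left_mem)))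
      (leadingCoeff_ne_zero.2 (hP _ he.right_mem)) h2.symm
  · rw [resonanceMult, hK₀ k, hS, Finset.sum_product, Finset.sum_sigma]
    congr 1
    refine Finset.sum_congr rfl fun n _ => Finset.sum_congr rfl fun j _ => ?_
    rw [Fintype.sum_bool]

end Resonances

end PointInteraction

theorem theoremt (N : ℕ) (hN : 2 ≤ N) (a : Fin N → ℂ) (Y : Fin N → PointInteraction.E3)
    (hY : Function.Injective Y)
    (hA3 : ∀ n : ℕ, 3 ≤ n → n ≤ N →
      PointInteraction.freqPoly a Y (-PointInteraction.size Y n) ≠ 0 ∧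
      (PointInteraction.freqPoly a Y (-PointInteraction.size Y n)).natDegree = N - n)
    (hA4 : ∀ m : ℕ, 2 ≤ m → m ≤ N - 1 →
      PointInteraction.size Y (m + 1) - PointInteraction.size Y m <
        PointInteraction.size Y m - PointInteraction.size Y (m - 1) ∧
      0 < PointInteraction.size Y (m + 1) - PointInteraction.size Y m) :
    -- the distribution diagram exists, and (i), (ii) hold for it
    Nonempty (PointInteraction.DistributionDiagram a Y) ∧
    (∀ L : PointInteraction.DistributionDiagram a Y,
      -- (i)
      L.M = N - 1 ∧
      (∀ m : ℕ, 1 ≤ m → m ≤ N - 1 →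
        L.slope (N - m) = 1 / (PointInteraction.size Y (m + 1) - PointInteraction.size Y m)) ∧
      -- (ii), the multiplicities
      L.mult (N - 1) = 2 ∧
      (∀ n : ℕ, 1 ≤ n → n ≤ N - 2 → L.mult n = 1) ∧
      -- (ii), the number of asymptotic sequences
      ∑ n ∈ Finset.Icc 1 L.M, 2 * L.mult n = 2 * N ∧
      -- (ii), the decomposition of the multiset of resonances
      ∃ (ω : ℕ → ℕ → ℂ) (t₀ : ℕ → ℕ → ℕ) (kplus kminus : ℕ → ℕ → ℕ → ℂ) (K₀ : Multiset ℂ),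
        (∀ n ∈ Finset.Icc 1 L.M,
          (L.segPoly n).roots = (Multiset.range (L.mult n)).map (ω n)) ∧
        (∀ n ∈ Finset.Icc 1 L.M, ∀ j ∈ Finset.range (L.mult n),
          ω n j ≠ 0 ∧ 1 ≤ t₀ n j ∧
          PointInteraction.HasLogAsymptotics 1 (L.slope n) (ω n j) (kplus n j) ∧
          PointInteraction.HasLogAsymptotics (-1) (L.slope n) (ω n j) (kminus n j)) ∧
        (∀ z : ℂ, PointInteraction.resonanceMult a Y z =
          (K₀.count z : ℕ∞) +
          ∑ n ∈ Finset.Icc 1 L.M, ∑ j ∈ Finset.range (L.mult n),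
            (PointInteraction.seqCount (t₀ n j) (kplus n j) z +
              PointInteraction.seqCount (t₀ n j) (kminus n j) z))) ∧
    -- (iii)
    ∃ R : ℝ, 0 ≤ R ∧ ∀ k : ℂ, PointInteraction.IsResonance a Y k → R ≤ ‖k‖ →
      PointInteraction.resonanceMult a Y k = 1 := by
  obtain ⟨hchain, hdeg, hdegN, hslope⟩ := PointInteraction.sizeVertex_isEdgeChain hN hY hA3 hA4
  have huniq := fun L => hchain.diagram_unique L
  have hL : ∀ L : PointInteraction.DistributionDiagram a Y, PointInteraction.IsEdgeChain
      (PointInteraction.freqs a Y) (PointInteraction.freqPoly a Y) L.M L.vertex := by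
    intro L
    obtain ⟨hM, hv⟩ := huniq L
    refine ⟨L.vertex_mem 0 (by omega), fun n h1 hn => ?_, L.vertex_zero, L.vertex_last⟩
    rw [hv n (by omega), hv (n - 1) (by omega)]
    exact hchain.isEdge n h1 (by omega)
  obtain ⟨L₀⟩ := hchain.nonempty_diagram
  refine ⟨⟨L₀⟩, fun L => ?_, (L₀.exists_decomposition hY (hL L₀)).2⟩
  obtain ⟨hM, hv⟩ := huniq L
  have hlast : L.mult (N - 1) = 2 := by
    rw [PointInteraction.DistributionDiagram.mult, hv _ le_rfl, hv (N - 1 - 1) (by omega), hdegN,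
      hdeg _ (by omega)]
    omega
  have hmult : ∀ n : ℕ, 1 ≤ n → n ≤ N - 2 → L.mult n = 1 := by
    intro n h1 hn
    rw [PointInteraction.DistributionDiagram.mult, hv n (by omega), hv (n - 1) (by omega),
      hdeg _ (by omega), hdeg _ (by omega)]
    omega
  refine ⟨hM, fun m h1 hm => ?_, hlast, hmult, ?_, (L.exists_decomposition hY (hL L)).1⟩
  · rw [← hslope m h1 (by omega), PointInteraction.DistributionDiagram.slope,
      PointInteraction.edgeSlope, hv _ (by omega), hv _ (by omega)]
  · rw [hM]
    obtain ⟨m, rfl⟩ : ∃ m, N = m + 2 := ⟨N - 2, by omega⟩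
    rw [show m + 2 - 1 = m + 1 by omega] at hlast ⊢
    rw [Finset.sum_Icc_succ_top (by omega), hlast, Finset.sum_congr rfl fun n hn => by
      rw [hmult n (Finset.mem_Icc.1 hn).1 (by simpa using (Finset.mem_Icc.1 hn).2)]]
    simp
    ring
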